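/- For a measurable function $f$ on a measure space $(\Omega,\nu)$ let $\mu(t,f)=\inf\{s\ge 0:\ \nu(\{|f|>s\})\le t\}$, $t>0$, be its decreasing rearrangement. For functions $x,y\in L_1+L_\infty$ on $(0,\infty)$ (with Lebesgue measure), Hardy–Littlewood submajorization $y\prec\prec x$ means that $\int_0^t\mu(s,y)\,ds\le\int_0^t\mu(s,x)\,ds$ for all $t>0$. Functions on $(0,1)$ are extended by zero to $(0,\infty)$. For $x\in L_2(0,1)$ put $$(Tx)(t)=t^{-\frac12}\int_0^t x(s)\,ds+\int_t^1\frac{x(s)\,ds}{s^{\frac12}},\qquad 0<t<1.$$ Let $d\ge 1$ be an integer, and let $(1-\Delta)^{-\frac d4}$ be the operator on $L_2(\mathbb{R}^d)$ that, on the Fourier side, multiplies by the symbol $(1+|\xi|^2)^{-\frac d4}$, where $\xi$ is the angular frequency, so that $-\Delta$ has the symbol $|\xi|^2$. There exists a constant $c_d>0$, depending only on $d$, such that for every (complex-valued) $x\in L_2(\mathbb{R}^d)$ the functions $\mu\big((1-\Delta)^{-\frac d4}x\big)\chi_{(0,1)}$ and $T(\mu(x)\chi_{(0,1)})$ belong to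 $L_1+L_\infty$ on $(0,\infty)$ and $$\mu\big((1-\Delta)^{-\frac d4}x\big)\chi_{(0,1)}\prec\prec c_d\,T\big(\mu(x)\chi_{(0,1)}\big).$$ -/

import Mathlib

open MeasureTheory Set
open scoped ENNReal FourierTransform

noncomputable section

namespace DistSobolev

/-- The decreasing rearrangement of `f` with respect to `ν`,
`t ↦ inf {s ≥ 0 : ν {|f| > s} ≤ t}`, considered for `t > 0`. -/
def rearrangement {α E : Type*} [MeasurableSpace α] [NormedAddCommGroup E]
    (ν : Measure α) (f : α → E) (t : ℝ) : ℝ :=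
  sInf {s : ℝ | 0 ≤ s ∧ ν {a | s < ‖f a‖} ≤ ENNReal.ofReal t}

/-- Membership in `L₁ + L_∞`. -/
def MemL1AddLinfty {α E : Type*} [MeasurableSpace α] [NormedAddCommGroup E]
    (ν : Measure α) (f : α → E) : Prop :=
  ∃ g h : α → E, MemLp g 1 ν ∧ MemLp h ∞ ν ∧ f =ᵐ[ν] g + h

/-- Hardy-Littlewood submajorization `y ≺≺ x`, a relation on `L₁ + L_∞`: for every `t > 0` the
integral of the decreasing rearrangement of `y` over `(0, t)` is at most that of `x`. -/
def Submajorized {α E : Type*} [MeasurableSpace α] [NormedAddCommGroup E]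
    (ν : Measure α) (y x : α → E) : Prop :=
  MemL1AddLinfty ν y ∧ MemL1AddLinfty ν x ∧
    ∀ t : ℝ, 0 < t →
      ∫⁻ s in Ioo 0 t, ENNReal.ofReal (rearrangement ν y s) ≤
        ∫⁻ s in Ioo 0 t, ENNReal.ofReal (rearrangement ν x s)

/-- The Hardy-type operator
`(T x)(t) = t ^ (-1/2) ∫_0^t x(s) ds + ∫_t^1 x(s) s ^ (-1/2) ds` for `0 < t < 1`;
functions on `(0, 1)` are extended by zero. -/
def hardyT (x : ℝ → ℝ) : ℝ → ℝ :=
  (Ioo (0 : ℝ) 1).indicator fun t =>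
    t ^ (-(1 / 2) : ℝ) * (∫ s in (0 : ℝ)..t, x s) + ∫ s in t..(1 : ℝ), x s / s ^ (1 / 2 : ℝ)

/-- The symbol `(1 + |2πξ|²) ^ (-d/4)` of `(1 - Δ) ^ (-d/4)` on `ℝ^d`. With Mathlib's convention
`𝓕 f ξ = ∫ exp (-2πi⟨v, ξ⟩) f v dv`, the operator `-Δ` has the symbol `|2πξ|²`. -/
def symbol (d : ℕ) (ξ : EuclideanSpace ℝ (Fin d)) : ℂ :=
  (((1 + (2 * Real.pi * ‖ξ‖) ^ 2) ^ (-(d : ℝ) / 4) : ℝ) : ℂ)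

theorem memLp_symbol (d : ℕ) : MemLp (symbol d) ∞ volume := by
  refine memLp_top_of_bound ?_ 1 (Filter.Eventually.of_forall fun ξ => ?_)
  · refine Continuous.aestronglyMeasurable ?_
    unfold symbol
    refine Complex.continuous_ofReal.comp (Continuous.rpow_const (by fun_prop) fun ξ => ?_)
    exact Or.inl (by positivity)
  · rw [symbol, Complex.norm_real, Real.norm_of_nonneg (by positivity)]
    refine Real.rpow_le_one_of_one_le_of_nonpos ?_ ?_
    · have : 0 ≤ (2 * Real.pi * ‖ξ‖) ^ 2 := sq_nonneg _
      linarith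
    · have : (0 : ℝ) ≤ d := Nat.cast_nonneg d
      linarith

/-- The operator `(1 - Δ) ^ (-d/4)` on `L₂(ℝ^d)`: multiplication by its symbol on the Fourier
side. -/
def besselPotential (d : ℕ) (x : Lp ℂ 2 (volume : Measure (EuclideanSpace ℝ (Fin d)))) :
    Lp ℂ 2 (volume : Measure (EuclideanSpace ℝ (Fin d))) :=
  𝓕⁻ ((memLp_symbol d).toLp (symbol d) • 𝓕 x)

end DistSobolev

end

/-!
The plan is to bound `∫_0^t μ(s, B x) ds`, where `B = (1 - Δ)^(-d/4)` and `0 < t ≤ 1`, by a multiple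
of `t ∫_0^1 max(t, r)^(-1/2) μ(r, x) dr`. On `(0, 1)` the integral here is `T(μ(x))(t)`
(`hardyT_indicator_eq`), a decreasing function of `t`, so the right side is at most the integral of
`T(μ(x))` over `(0, t)`.

By duality (`exists_weight_lintegral_rearrangement_le`), `∫_0^t μ(s, B x) ds` is at most `∫ |B x| h`
for some weight `0 ≤ h ≤ 1` of mass at most `t`. The formula
`(1 + |η|²)^(-d/4) = Γ(d/4)⁻¹ ∫_0^∞ s^(d/4 - 1) e^(-s) e^(-s|η|²) ds` exhibits `B` as an average of
the heat operators `e^(sΔ)`, which avoids any explicit knowledge of its convolution kernel, and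
Plancherel's theorem turns this into
`∫ |B x| h ≤ Γ(d/4)⁻¹ ∫_0^∞ s^(d/4 - 1) e^(-s) ∫ |x| (p_s * h) ds` with the heat kernels `p_s`
(`norm_inner_besselPotential_le`).

Put `u = (4πs)^(d/2)`. The weight `p_s * h` has mass at most `t` and is bounded both by `1` and by
`t / u`. The Hardy-Littlewood inequality `lintegral_enorm_mul_le` therefore gives
`∫ |x| (p_s * h) ≤ (t / max(t, u)) ∫_0^max(t, u) μ(r, x) dr`. The part of the last integral over
`r ≥ 1` is controlled by `∫_0^1 μ(r, x) dr` because `μ(x)` decreases. In the part over `r < 1` the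
order of integration is exchanged, and
`∫_0^∞ s^(d/4 - 1) min(1/ρ, 1/u) ds = C ρ^(-1/2)` with `ρ = max(t, r)` yields the kernel of `T`
(`lintegral_gammaWeight_mul_le`).
-/

namespace DistSobolev

/-! ### Decreasing rearrangement and weights -/

section Rearrangement

variable {α E : Type*} [MeasurableSpace α] [NormedAddCommGroup E] {ν : Measure α} {f : α → E}

theorem rearrangement_nonneg (ν : Measure α) (f : α → E) (t : ℝ) : 0 ≤ rearrangement ν f t :=
  Real.sInf_nonneg fun _ hs => hs.1

theorem rearrangement_le {s t : ℝ} (hs : 0 ≤ s) (h : ν {a | s < ‖f a‖} ≤ ENNReal.ofReal t) :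
    rearrangement ν f t ≤ s :=
  csInf_le ⟨0, fun _ hs => hs.1⟩ ⟨hs, h⟩

/-- The superlevel sets of `f` have arbitrarily small measure. This is exactly what makes the
infimum defining `rearrangement ν f t` run over a nonempty set for every `t > 0`. -/
def HasSmallTails (ν : Measure α) (f : α → E) : Prop :=
  ∀ t : ℝ, 0 < t → ∃ s : ℝ, 0 ≤ s ∧ ν {a | s < ‖f a‖} ≤ ENNReal.ofReal t

theorem le_rearrangement (hf : HasSmallTails ν f) {s t : ℝ} (ht : 0 < t)
    (h : ENNReal.ofReal t < ν {a | s < ‖f a‖}) : s ≤ rearrangement ν f t := by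
  refine le_csInf (hf t ht) fun r hr => ?_
  by_contra! hlt
  refine absurd (h.trans_le ((measure_mono fun a ha => ?_).trans hr.2)) (lt_irrefl _)
  exact hlt.trans ha

/-- The rearrangement and the distribution function are generalized inverses of each other. -/
theorem lt_rearrangement_iff (hf : HasSmallTails ν f) {s t : ℝ} (hs : 0 ≤ s) (ht : 0 < t) :
    s < rearrangement ν f t ↔ ENNReal.ofReal t < ν {a | s < ‖f a‖} := by
  refine ⟨fun h => ?_, fun h => ?_⟩
  · by_contra! hle
    exact absurd (rearrangement_le hs hle) (not_le.2 h)
  · -- the distribution function is right-continuous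
    have hU : {a | s < ‖f a‖} = ⋃ n : ℕ, {a | s + 1 / ((n : ℝ) + 1) < ‖f a‖} := by
      ext a
      simp only [mem_ofPred_eq, mem_iUnion]
      refine ⟨fun ha => ?_, fun ⟨n, hn⟩ => ?_⟩
      · obtain ⟨n, hn⟩ := exists_nat_one_div_lt (sub_pos.2 ha)
        exact ⟨n, by linarith⟩
      · have : (0 : ℝ) < 1 / ((n : ℝ) + 1) := by positivity
        linarith
    have hmono : Monotone fun n : ℕ => {a | s + 1 / ((n : ℝ) + 1) < ‖f a‖} := by
      intro m n hmn a ha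
      have h1 : 1 / ((n : ℝ) + 1) ≤ 1 / ((m : ℝ) + 1) := by gcongr
      simp only [mem_ofPred_eq] at ha ⊢
      linarith
    rw [hU, hmono.measure_iUnion] at h
    obtain ⟨n, hn⟩ := lt_iSup_iff.1 h
    have : (0 : ℝ) < 1 / ((n : ℝ) + 1) := by positivity
    linarith [le_rearrangement hf ht hn]

theorem antitoneOn_rearrangement (hf : HasSmallTails ν f) :
    AntitoneOn (rearrangement ν f) (Ioi 0) := by
  intro s hs t _ hst
  refine csInf_le_csInf ⟨0, fun _ hs => hs.1⟩ (hf s hs) fun r hr => ⟨hr.1, hr.2.trans ?_⟩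
  gcongr

/-- Layer cake formula for the integral of the rearrangement over an initial interval. -/
theorem lintegral_rearrangement (hf : HasSmallTails ν f) (u : ℝ) :
    ∫⁻ r in Ioo 0 u, ENNReal.ofReal (rearrangement ν f r) =
      ∫⁻ s in Ioi (0 : ℝ), min (ENNReal.ofReal u) (ν {a | s < ‖f a‖}) := by
  rw [lintegral_eq_lintegral_meas_lt (volume.restrict (Ioo 0 u))
    (Filter.Eventually.of_forall fun r => rearrangement_nonneg ν f r)
    (aemeasurable_restrict_of_antitoneOn measurableSet_Ioo
      ((antitoneOn_rearrangement hf).mono Ioo_subset_Ioi_self))]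
  refine setLIntegral_congr_fun measurableSet_Ioi fun s hs => ?_
  have hset : {r | s < rearrangement ν f r} ∩ Ioo 0 u =
      {r | ENNReal.ofReal r < ν {a | s < ‖f a‖}} ∩ Ioo 0 u := by
    ext r
    simp only [mem_inter_iff, mem_ofPred_eq, and_congr_left_iff]
    exact fun hr => lt_rearrangement_iff hf (le_of_lt hs) hr.1
  rw [Measure.restrict_apply' measurableSet_Ioo, hset]
  rcases eq_or_ne (ν {a | s < ‖f a‖}) ∞ with h | h
  · simp [h]
  · have : {r | ENNReal.ofReal r < ν {a | s < ‖f a‖}} ∩ Ioo 0 u =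
        Ioo 0 (min u (ν {a | s < ‖f a‖}).toReal) := by
      ext r
      simp only [mem_inter_iff, mem_ofPred_eq, mem_Ioo, lt_min_iff]
      constructor
      · rintro ⟨h1, h2, h3⟩
        exact ⟨h2, h3, (ENNReal.ofReal_lt_iff_lt_toReal h2.le h).1 h1⟩
      · rintro ⟨h2, h3, h1⟩
        exact ⟨(ENNReal.ofReal_lt_iff_lt_toReal h2.le h).2 h1, h2, h3⟩
    rw [this, Real.volume_Ioo, sub_zero, ENNReal.ofReal_min, ENNReal.ofReal_toReal h]

/-- Hardy-Littlewood inequality for a weight `k` with prescribed upper bound and total mass: the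
extremal weight is concentrated where `f` is largest. -/
theorem lintegral_enorm_mul_le (hf : HasSmallTails ν f) (hfm : StronglyMeasurable f)
    {k : α → ℝ≥0∞} (hk : Measurable k) {M τ : ℝ} (hM : 0 < M)
    (hkM : ∀ a, k a ≤ ENNReal.ofReal M) (hkτ : ∫⁻ a, k a ∂ν ≤ ENNReal.ofReal τ) :
    ∫⁻ a, ‖f a‖ₑ * k a ∂ν ≤
      ENNReal.ofReal M * ∫⁻ r in Ioo 0 (τ / M), ENNReal.ofReal (rearrangement ν f r) := by
  have h1 : ∫⁻ a, ‖f a‖ₑ * k a ∂ν = ∫⁻ a, ENNReal.ofReal ‖f a‖ ∂(ν.withDensity k) := by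
    rw [lintegral_withDensity_eq_lintegral_mul _ hk hfm.norm.measurable.ennreal_ofReal]
    refine lintegral_congr fun a => ?_
    simp [mul_comm]
  rw [h1, lintegral_eq_lintegral_meas_lt _ (Filter.Eventually.of_forall fun a => norm_nonneg _)
    hfm.norm.measurable.aemeasurable, lintegral_rearrangement hf,
    ← lintegral_const_mul' _ _ ENNReal.ofReal_ne_top]
  refine lintegral_mono fun s => ?_
  have hms : MeasurableSet {a | s < ‖f a‖} :=
    measurableSet_lt measurable_const hfm.norm.measurable
  rw [withDensity_apply _ hms, mul_min, ← ENNReal.ofReal_mul hM.le, mul_div_cancel₀ _ hM.ne']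
  refine le_min ((setLIntegral_le_lintegral _ _).trans hkτ) ?_
  calc ∫⁻ a in {a | s < ‖f a‖}, k a ∂ν ≤ ∫⁻ _ in {a | s < ‖f a‖}, ENNReal.ofReal M ∂ν :=
        lintegral_mono fun a => hkM a
    _ = _ := by simp

/-- The integral of the rearrangement over `(0, t)` is attained by pairing `|f|` with a weight
`0 ≤ h ≤ 1` of mass at most `t`. The measure may have atoms, so `h` is the indicator of
`{|f| > l}` plus a multiple of the indicator of `{|f| = l}`, where `l` is the rearrangement
at `t`. -/
theorem exists_weight_lintegral_rearrangement_le (hfm : StronglyMeasurable f)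
    (hfin : ∀ s : ℝ, 0 < s → ν {a | s < ‖f a‖} ≠ ∞) (hf : HasSmallTails ν f) {t : ℝ} (ht : 0 < t) :
    ∃ h : α → ℝ≥0∞, Measurable h ∧ (∀ a, h a ≤ 1) ∧ ∫⁻ a, h a ∂ν ≤ ENNReal.ofReal t ∧
      ∫⁻ r in Ioo 0 t, ENNReal.ofReal (rearrangement ν f r) ≤ ∫⁻ a, ‖f a‖ₑ * h a ∂ν := by
  set l := rearrangement ν f t
  have hl0 : 0 ≤ l := rearrangement_nonneg ν f t
  have hnm := hfm.norm.measurable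
  have hE (s : ℝ) : MeasurableSet {a | s < ‖f a‖} := measurableSet_lt measurable_const hnm
  have hE2 : MeasurableSet {a | ‖f a‖ = l} := measurableSet_eq_fun hnm measurable_const
  set p := ν {a | l < ‖f a‖}
  set q := ν {a | ‖f a‖ = l}
  have hpt : p ≤ ENNReal.ofReal t := by
    by_contra! h
    exact lt_irrefl _ ((lt_rearrangement_iff hf hl0 ht).2 h)
  obtain ⟨θ, hθ1, hθt, hθ⟩ : ∃ θ : ℝ≥0∞, θ ≤ 1 ∧ p + θ * q ≤ ENNReal.ofReal t ∧
      (0 < l → ENNReal.ofReal t ≤ p + θ * q) := by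
    -- at level `0` the set `{f = 0}` may have infinite measure, but it does not contribute
    rcases hl0.eq_or_lt with h0 | h0
    · exact ⟨0, by simp, by simpa using hpt, fun h => absurd h (by rw [← h0]; simp)⟩
    have hle : {a | l ≤ ‖f a‖} = {a | l < ‖f a‖} ∪ {a | ‖f a‖ = l} := by
      ext a
      simp [le_iff_lt_or_eq, eq_comm]
    have hdisj : Disjoint {a | l < ‖f a‖} {a | ‖f a‖ = l} :=
      Set.disjoint_left.2 fun a (h1 : l < ‖f a‖) (h2 : ‖f a‖ = l) => h1.ne' h2
    have hpq : ν {a | l ≤ ‖f a‖} = p + q := by rw [hle, measure_union hdisj hE2]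
    have hqtop : q ≠ ∞ := by
      refine ((measure_mono fun a ha => ?_).trans_lt (hfin (l / 2) (by positivity)).lt_top).ne
      have : ‖f a‖ = l := ha
      simp only [mem_ofPred_eq]
      linarith
    have htpq : ENNReal.ofReal t ≤ p + q := by
      rw [← hpq]
      have hI : {a | l ≤ ‖f a‖} = ⋂ n : ℕ, {a | l - l / ((n : ℝ) + 2) < ‖f a‖} := by
        ext a
        simp only [mem_ofPred_eq, mem_iInter]
        refine ⟨fun ha n => ?_, fun ha => ?_⟩
        · have : 0 < l / ((n : ℝ) + 2) := by positivity
          linarith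
        · by_contra! hlt
          obtain ⟨n, hn⟩ := exists_nat_one_div_lt (div_pos (sub_pos.2 hlt) h0)
          have h1 : l / ((n : ℝ) + 2) ≤ l * (1 / ((n : ℝ) + 1)) := by
            rw [mul_one_div]
            gcongr
            norm_num
          have h2 : l * (1 / ((n : ℝ) + 1)) < l - ‖f a‖ := by
            rwa [lt_div_iff₀ h0, mul_comm] at hn
          have := ha n
          linarith
      have hanti : Antitone fun n : ℕ => {a | l - l / ((n : ℝ) + 2) < ‖f a‖} := by
        intro m n hmn a ha
        have h1 : l / ((n : ℝ) + 2) ≤ l / ((m : ℝ) + 2) := by gcongr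
        simp only [mem_ofPred_eq] at ha ⊢
        linarith
      rw [hI, hanti.measure_iInter (fun n => (hE _).nullMeasurableSet)
        ⟨0, hfin _ (by simp only [Nat.cast_zero, zero_add]; linarith)⟩]
      refine le_iInf fun n => ?_
      have hpos : 0 < l / ((n : ℝ) + 2) := by positivity
      have hle' : l / ((n : ℝ) + 2) ≤ l := div_le_self hl0 (by linarith [n.cast_nonneg (α := ℝ)])
      exact ((lt_rearrangement_iff hf (by linarith) ht).1 (by linarith)).le
    have hsub : ENNReal.ofReal t - p ≤ q := tsub_le_iff_left.2 htpq
    have hmul : (ENNReal.ofReal t - p) / q * q = ENNReal.ofReal t - p :=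
      ENNReal.div_mul_cancel' (fun h => by simpa [h] using hsub) fun h => absurd h hqtop
    refine ⟨(ENNReal.ofReal t - p) / q, ENNReal.div_le_of_le_mul (by simpa using hsub), ?_, ?_⟩
    · rw [hmul, add_tsub_cancel_of_le hpt]
    · rw [hmul, add_tsub_cancel_of_le hpt]
      exact fun _ => le_rfl
  let h : α → ℝ≥0∞ := {a | l < ‖f a‖}.indicator 1 + {a | ‖f a‖ = l}.indicator fun _ => θ
  have hhm : Measurable h :=
    ((measurable_one.indicator (hE l))).add (measurable_const.indicator hE2)
  refine ⟨h, hhm, fun a => ?_, ?_, ?_⟩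
  · rcases lt_trichotomy l ‖f a‖ with h1 | h1 | h1
    · simp [h, h1, h1.ne']
    · simpa [h, ← h1] using hθ1
    · simp [h, h1.not_gt, h1.ne]
  · simp only [h, Pi.add_apply]
    rw [lintegral_add_left (measurable_one.indicator (hE l)), lintegral_indicator_one (hE l),
      lintegral_indicator_const hE2]
    exact hθt
  · have h1 : ∫⁻ a, ‖f a‖ₑ * h a ∂ν = ∫⁻ a, ENNReal.ofReal ‖f a‖ ∂(ν.withDensity h) := by
      rw [lintegral_withDensity_eq_lintegral_mul _ hhm hnm.ennreal_ofReal]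
      refine lintegral_congr fun a => ?_
      simp [mul_comm]
    rw [h1, lintegral_eq_lintegral_meas_lt _ (Filter.Eventually.of_forall fun a => norm_nonneg _)
      hnm.aemeasurable, lintegral_rearrangement hf]
    refine setLIntegral_mono' measurableSet_Ioi fun s hs => ?_
    rw [withDensity_apply _ (hE s)]
    have hle : ∀ A : Set α, MeasurableSet A → ∫⁻ a in A, h a ∂ν =
        ν ({a | l < ‖f a‖} ∩ A) + θ * ν ({a | ‖f a‖ = l} ∩ A) := by
      intro A hA
      simp only [h, Pi.add_apply]
      rw [lintegral_add_left (measurable_one.indicator (hE l)), lintegral_indicator_one (hE l),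
        lintegral_indicator_const hE2, Measure.restrict_apply (hE l), Measure.restrict_apply hE2]
    rw [hle _ (hE s)]
    rcases lt_or_ge s l with hsl | hsl
    · refine (min_le_left _ _).trans ((hθ ((le_of_lt hs).trans_lt hsl)).trans ?_)
      rw [inter_eq_left.2, inter_eq_left.2]
      · exact fun a (ha : ‖f a‖ = l) => by simpa [ha] using hsl
      · exact fun a (ha : l < ‖f a‖) => hsl.trans ha
    · refine (min_le_right _ _).trans (le_add_right (measure_mono fun a ha => ⟨?_, ha⟩))
      exact hsl.trans_lt ha

/-- Chebyshev's inequality, as a bound on superlevel sets of an `L₂` function. -/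
theorem meas_lt_norm_le_of_memLp_two (hf : MemLp f 2 ν) {s : ℝ} (hs : 0 < s) :
    ν {a | s < ‖f a‖} ≤ ENNReal.ofReal ((eLpNorm f 2 ν).toReal ^ 2 / s ^ 2) := by
  have h := meas_ge_le_mul_pow_eLpNorm_enorm ν (p := 2) (by norm_num) (by norm_num)
    hf.aestronglyMeasurable (ε := ENNReal.ofReal s) (by simpa using hs) (by simp)
  refine (measure_mono fun a ha => ?_).trans (h.trans (le_of_eq ?_))
  · simp only [mem_ofPred_eq] at ha ⊢
    rw [← ofReal_norm]
    exact ENNReal.ofReal_le_ofReal ha.le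
  · rw [ENNReal.ofReal_div_of_pos (by positivity), ENNReal.ofReal_pow ENNReal.toReal_nonneg,
      ENNReal.ofReal_toReal hf.2.ne, ENNReal.ofReal_pow hs.le, ENNReal.div_eq_inv_mul]
    simp [ENNReal.inv_pow]

theorem meas_const_mul_rpow_lt_norm_le (hf : MemLp f 2 ν) {t : ℝ} (ht : 0 < t) {A : ℝ}
    (hA : (eLpNorm f 2 ν).toReal ≤ A) (hA0 : 0 < A) :
    ν {a | A * t ^ (-(1 / 2) : ℝ) < ‖f a‖} ≤ ENNReal.ofReal t := by
  refine (meas_lt_norm_le_of_memLp_two hf (by positivity)).trans (ENNReal.ofReal_le_ofReal ?_)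
  have h2 : (t ^ (-(1 / 2) : ℝ)) ^ 2 = t⁻¹ := by
    rw [← Real.rpow_natCast, ← Real.rpow_mul ht.le, ← Real.rpow_neg_one]
    norm_num
  rw [mul_pow, h2, div_le_iff₀ (by positivity)]
  have : t * (A ^ 2 * t⁻¹) = A ^ 2 := by field_simp
  rw [this]
  gcongr

theorem hasSmallTails_of_memLp_two (hf : MemLp f 2 ν) : HasSmallTails ν f := fun _ ht =>
  ⟨_, by positivity, meas_const_mul_rpow_lt_norm_le hf ht (le_add_of_nonneg_right zero_le_one)
    (by positivity)⟩

theorem lintegral_rearrangement_ne_top (hf : MemLp f 2 ν) :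
    ∫⁻ r in Ioo (0 : ℝ) 1, ENNReal.ofReal (rearrangement ν f r) ≠ ∞ := by
  set A := (eLpNorm f 2 ν).toReal + 1
  have hA0 : 0 < A := by positivity
  have hint : IntegrableOn (fun r : ℝ => A * r ^ (-(1 / 2) : ℝ)) (Ioo 0 1) := by
    refine Integrable.const_mul ?_ A
    exact (intervalIntegral.integrableOn_Ioo_rpow_iff zero_lt_one).2 (by norm_num)
  refine (lt_of_le_of_lt (setLIntegral_mono' measurableSet_Ioo fun r hr => ?_)
    hint.lintegral_lt_top).ne
  refine ENNReal.ofReal_le_ofReal (rearrangement_le (by have := hr.1; positivity) ?_)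
  exact meas_const_mul_rpow_lt_norm_le hf hr.1 (by linarith) hA0

end Rearrangement

/-! ### The Fourier transform on `L₁ ∩ L₂` and the heat semigroup -/

section FourierLp

variable {V : Type*} [NormedAddCommGroup V] [InnerProductSpace ℝ V] [FiniteDimensional ℝ V]
  [MeasurableSpace V] [BorelSpace V]

theorem integral_fourier_mul_eq {f g : V → ℂ} (hf : Integrable f) (hg : Integrable g) :
    ∫ ξ, 𝓕 f ξ * g ξ = ∫ v, f v * 𝓕 g v := by
  have := VectorFourier.integral_fourierIntegral_smul_eq_flip (L := innerₗ V)
    Real.continuous_fourierChar continuous_inner hf hg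
  simpa using! this

theorem continuous_fourier_of_integrable {f : V → ℂ} (hf : Integrable f) : Continuous (𝓕 f) :=
  VectorFourier.fourierIntegral_continuous Real.continuous_fourierChar continuous_inner hf

theorem norm_fourier_le (f : V → ℂ) (ξ : V) : ‖𝓕 f ξ‖ ≤ ∫ v, ‖f v‖ :=
  VectorFourier.norm_fourierIntegral_le_integral_norm _ _ _ f ξ

/-- The Fourier transform of `L₂`, which Mathlib constructs by extension from Schwartz functions,
is given by the Fourier integral on `L₁ ∩ L₂`. -/
theorem Lp_fourier_ae_eq (f : Lp ℂ 2 (volume : Measure V)) (hf : Integrable f) :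
    (𝓕 f : Lp ℂ 2 (volume : Measure V)) =ᵐ[volume] 𝓕 (f : V → ℂ) := by
  refine ae_eq_of_integral_contDiff_smul_eq
    ((Lp.memLp _).locallyIntegrable (by norm_num))
    (continuous_fourier_of_integrable hf).locallyIntegrable fun g hg hgs => ?_
  let φ : SchwartzMap V ℂ := HasCompactSupport.toSchwartzMap (f := fun v => (g v : ℂ))
    (hgs.comp_left Complex.ofReal_zero) (Complex.ofRealCLM.contDiff.comp hg)
  have h1 : ∫ v, g v • (𝓕 f : Lp ℂ 2 (volume : Measure V)) v =
      Lp.toTemperedDistribution (𝓕 f) φ := by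
    rw [Lp.toTemperedDistribution_apply]
    rfl
  rw [h1, ← Lp.fourier_toTemperedDistribution_eq, TemperedDistribution.fourier_apply,
    Lp.toTemperedDistribution_apply]
  have h2 := integral_fourier_mul_eq (φ.integrable (μ := volume)) hf
  simp only [SchwartzMap.fourier_coe, smul_eq_mul]
  rw [h2]
  rfl

end FourierLp

section Heat

variable {d : ℕ}

/-- The Gauss-Weierstrass (heat) kernel on `ℝ^d` at time `s`. -/
noncomputable def heatKernel (d : ℕ) (s : ℝ) (v : EuclideanSpace ℝ (Fin d)) : ℝ :=
  ((4 * Real.pi * s) ^ ((d : ℝ) / 2))⁻¹ * Real.exp (-‖v‖ ^ 2 / (4 * s))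

/-- The Fourier symbol of the heat semigroup at time `s`. -/
noncomputable def heatSymbol (d : ℕ) (s : ℝ) (ξ : EuclideanSpace ℝ (Fin d)) : ℝ :=
  Real.exp (-(s * (2 * Real.pi * ‖ξ‖) ^ 2))

theorem heatKernel_nonneg {s : ℝ} (hs : 0 ≤ s) (v : EuclideanSpace ℝ (Fin d)) :
    0 ≤ heatKernel d s v := by
  unfold heatKernel
  positivity

theorem heatKernel_le {s : ℝ} (hs : 0 < s) (v : EuclideanSpace ℝ (Fin d)) :
    heatKernel d s v ≤ ((4 * Real.pi * s) ^ ((d : ℝ) / 2))⁻¹ := by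
  unfold heatKernel
  refine mul_le_of_le_one_right (by positivity) (Real.exp_le_one_iff.2 ?_)
  rw [neg_div]
  exact neg_nonpos.2 (by positivity)

theorem heatKernel_sub_comm (s : ℝ) (v w : EuclideanSpace ℝ (Fin d)) :
    heatKernel d s (v - w) = heatKernel d s (w - v) := by
  simp only [heatKernel, norm_sub_rev]

theorem measurable_heatKernel :
    Measurable fun p : ℝ × EuclideanSpace ℝ (Fin d) => heatKernel d p.1 p.2 := by
  unfold heatKernel
  fun_prop

theorem integrable_heatKernel {s : ℝ} (hs : 0 < s) : Integrable (heatKernel d s) := by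
  have h := (GaussianFourier.integrable_cexp_neg_mul_sq_norm_add (b := ((1 / (4 * s) : ℝ) : ℂ))
    (by simpa using hs) 0 (0 : EuclideanSpace ℝ (Fin d))).norm
  refine (h.const_mul ((4 * Real.pi * s) ^ ((d : ℝ) / 2))⁻¹).congr
    (Filter.Eventually.of_forall fun v => ?_)
  simp only [heatKernel, zero_mul, add_zero, Complex.norm_exp]
  congr 2
  norm_cast
  ring

theorem lintegral_heatKernel {s : ℝ} (hs : 0 < s) :
    ∫⁻ v, ENNReal.ofReal (heatKernel d s v) = 1 := by
  rw [← ofReal_integral_eq_lintegral_ofReal (integrable_heatKernel hs)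
    (Filter.Eventually.of_forall fun v => heatKernel_nonneg hs.le v)]
  have h := GaussianFourier.integral_rexp_neg_mul_sq_norm (V := EuclideanSpace ℝ (Fin d))
    (b := 1 / (4 * s)) (by positivity)
  have h2 : ∀ v : EuclideanSpace ℝ (Fin d), -‖v‖ ^ 2 / (4 * s) = -(1 / (4 * s)) * ‖v‖ ^ 2 :=
    fun v => by ring
  simp only [heatKernel, integral_const_mul, h2]
  rw [h, finrank_euclideanSpace_fin,
    show Real.pi / (1 / (4 * s)) = 4 * Real.pi * s by field_simp,
    inv_mul_cancel₀ (by positivity), ENNReal.ofReal_one]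

theorem integrable_heatSymbol {s : ℝ} (hs : 0 < s) : Integrable (heatSymbol d s) := by
  have h := (GaussianFourier.integrable_cexp_neg_mul_sq_norm_add
    (b := ((4 * Real.pi ^ 2 * s : ℝ) : ℂ)) (by rw [Complex.ofReal_re]; positivity) 0
    (0 : EuclideanSpace ℝ (Fin d))).norm
  refine h.congr (Filter.Eventually.of_forall fun v => ?_)
  simp only [heatSymbol, zero_mul, add_zero, Complex.norm_exp]
  congr 1
  norm_cast
  ring

theorem measurable_heatSymbol :
    Measurable fun p : ℝ × EuclideanSpace ℝ (Fin d) => heatSymbol d p.1 p.2 := by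
  unfold heatSymbol
  fun_prop

/-- The Fourier transform of a modulated Gaussian is a translated heat kernel. -/
theorem fourier_heatSymbol {s : ℝ} (hs : 0 < s) (v w : EuclideanSpace ℝ (Fin d)) :
    𝓕 (fun ξ => Complex.exp (2 * Real.pi * Complex.I * (inner ℝ v ξ : ℝ)) *
      (heatSymbol d s ξ : ℂ)) w = (heatKernel d s (v - w) : ℂ) := by
  have hb : 0 < (((4 * Real.pi ^ 2 * s : ℝ) : ℂ)).re := by
    rw [Complex.ofReal_re]; positivity
  have h := fourier_gaussian_innerProductSpace' hb v w
  have h1 : (fun ξ => Complex.exp (2 * Real.pi * Complex.I * (inner ℝ v ξ : ℝ)) *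
      (heatSymbol d s ξ : ℂ)) = fun ξ => Complex.exp (-((4 * Real.pi ^ 2 * s : ℝ) : ℂ) * ‖ξ‖ ^ 2 +
        2 * Real.pi * Complex.I * (inner ℝ v ξ : ℝ)) := by
    ext ξ
    rw [heatSymbol, Complex.ofReal_exp, ← Complex.exp_add]
    congr 1
    push_cast
    ring
  rw [h1, h, heatKernel, finrank_euclideanSpace_fin, Complex.ofReal_mul _ (Real.exp _),
    Complex.ofReal_exp]
  congr 1
  · rw [← Real.inv_rpow (by positivity), Complex.ofReal_cpow (by positivity)]
    congr 1
    · push_cast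
      have := Real.pi_ne_zero
      field_simp
    · push_cast
      ring
  · congr 1
    push_cast
    have := Real.pi_ne_zero
    field_simp

open ComplexConjugate in
/-- The bilinear form of the heat semigroup, written on the Fourier side, is the one with the heat
kernel. -/
theorem norm_integral_heatSymbol_le {s : ℝ} (hs : 0 < s) {f g : EuclideanSpace ℝ (Fin d) → ℂ}
    (hf : Integrable f) (hg : Integrable g) :
    ENNReal.ofReal ‖∫ ξ, conj (𝓕 g ξ) * 𝓕 f ξ * heatSymbol d s ξ‖ ≤
      ∫⁻ v, ‖g v‖ₑ * ∫⁻ w, ‖f w‖ₑ * ENNReal.ofReal (heatKernel d s (v - w)) := by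
  let e (v ξ : EuclideanSpace ℝ (Fin d)) : ℂ :=
    Complex.exp (2 * Real.pi * Complex.I * (inner ℝ v ξ : ℝ))
  have hee (v ξ : EuclideanSpace ℝ (Fin d)) : ‖e v ξ‖ = 1 := by
    have : e v ξ = Complex.exp ((2 * Real.pi * inner ℝ v ξ : ℝ) * Complex.I) := by
      simp only [e]; congr 1; push_cast; ring
    rw [this, Complex.norm_exp_ofReal_mul_I]
  have hem : Continuous fun p : EuclideanSpace ℝ (Fin d) × EuclideanSpace ℝ (Fin d) =>
      e p.1 p.2 := by
    simp only [e]; fun_prop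
  have hconj (ξ : EuclideanSpace ℝ (Fin d)) : conj (𝓕 g ξ) = ∫ v, conj (g v) * e v ξ := by
    rw [Real.fourier_eq', ← integral_conj]
    refine integral_congr_ae (Filter.Eventually.of_forall fun v => ?_)
    simp only [smul_eq_mul, map_mul, ← Complex.exp_conj, e]
    rw [mul_comm]
    congr 2
    simp only [Complex.conj_ofReal, Complex.conj_I]
    push_cast
    ring
  have hfs : Integrable fun ξ => 𝓕 f ξ * heatSymbol d s ξ := by
    refine (integrable_heatSymbol hs).ofReal.bdd_mul
      (continuous_fourier_of_integrable hf).aestronglyMeasurable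
      (Filter.Eventually.of_forall fun ξ => norm_fourier_le f ξ)
  have key : ∫ ξ, conj (𝓕 g ξ) * 𝓕 f ξ * heatSymbol d s ξ =
      ∫ v, conj (g v) * ∫ w, f w * heatKernel d s (v - w) := by
    calc ∫ ξ, conj (𝓕 g ξ) * 𝓕 f ξ * heatSymbol d s ξ
        = ∫ ξ, ∫ v, e v ξ * (conj (g v) * (𝓕 f ξ * heatSymbol d s ξ)) := by
          refine integral_congr_ae (Filter.Eventually.of_forall fun ξ => ?_)
          simp only
          rw [hconj, mul_assoc, ← integral_mul_const]
          refine integral_congr_ae (Filter.Eventually.of_forall fun v => ?_)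
          simp only
          ring
      _ = ∫ v, ∫ ξ, e v ξ * (conj (g v) * (𝓕 f ξ * heatSymbol d s ξ)) := by
          refine integral_integral_swap ?_
          have hprod : Integrable (fun p : EuclideanSpace ℝ (Fin d) × EuclideanSpace ℝ (Fin d) =>
              conj (g p.2) * (𝓕 f p.1 * heatSymbol d s p.1)) (volume.prod volume) := by
            have hgc : Integrable fun v => conj (g v) :=
              (Complex.conjLIE.toContinuousLinearEquiv.integrable_comp_iff).2 hg
            exact (hfs.mul_prod hgc).congr (Filter.Eventually.of_forall fun p => mul_comm _ _)
          exact hprod.bdd_mul (c := 1) (hem.comp continuous_swap).aestronglyMeasurable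
            (Filter.Eventually.of_forall fun p => (hee _ _).le)
      _ = _ := by
          refine integral_congr_ae (Filter.Eventually.of_forall fun v => ?_)
          simp only
          have hG : Integrable fun ξ => e v ξ * (heatSymbol d s ξ : ℂ) :=
            (integrable_heatSymbol hs).ofReal.bdd_mul (c := 1)
              (hem.comp (by fun_prop : Continuous fun ξ => (v, ξ))).aestronglyMeasurable
              (Filter.Eventually.of_forall fun ξ => (hee _ _).le)
          have h1 := integral_fourier_mul_eq hf hG
          have h2 : ∫ ξ, e v ξ * (conj (g v) * (𝓕 f ξ * heatSymbol d s ξ)) =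
              conj (g v) * ∫ ξ, 𝓕 f ξ * (e v ξ * (heatSymbol d s ξ : ℂ)) := by
            rw [← integral_const_mul]
            refine integral_congr_ae (Filter.Eventually.of_forall fun ξ => ?_)
            simp only
            ring
          rw [h2, h1]
          congr 1
          refine integral_congr_ae (Filter.Eventually.of_forall fun w => ?_)
          simp only [e]
          rw [fourier_heatSymbol hs]
  rw [key, ofReal_norm]
  refine (enorm_integral_le_lintegral_enorm _).trans (lintegral_mono fun v => ?_)
  rw [enorm_mul]
  gcongr
  · exact (RCLike.enorm_conj (g v)).le
  refine (enorm_integral_le_lintegral_enorm _).trans (lintegral_mono fun w => ?_)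
  rw [enorm_mul]
  gcongr
  rw [← ofReal_norm, Complex.norm_real, Real.norm_of_nonneg (heatKernel_nonneg hs.le _)]

end Heat

/-! ### The Bessel potential as a mixture of heat operators -/

section Bessel

variable {d : ℕ}

/-- The density in `s` with which the heat semigroup is averaged to give the Bessel potential,
apart from the normalizing factor `Γ(d/4)⁻¹`. -/
noncomputable def gammaWeight (d : ℕ) (s : ℝ) : ℝ :=
  Real.exp (-s) * s ^ ((d : ℝ) / 4 - 1)

theorem gammaWeight_nonneg {s : ℝ} (hs : 0 ≤ s) : 0 ≤ gammaWeight d s := by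
  unfold gammaWeight
  positivity

theorem measurable_gammaWeight : Measurable (gammaWeight d) := by
  unfold gammaWeight
  fun_prop

theorem integrableOn_gammaWeight (hd : 0 < d) : IntegrableOn (gammaWeight d) (Ioi 0) :=
  Real.GammaIntegral_convergent (by positivity)

theorem lintegral_gammaWeight (hd : 0 < d) :
    ∫⁻ s in Ioi (0 : ℝ), ENNReal.ofReal (gammaWeight d s) =
      ENNReal.ofReal (Real.Gamma ((d : ℝ) / 4)) := by
  rw [← ofReal_integral_eq_lintegral_ofReal (integrableOn_gammaWeight hd)
    ((ae_restrict_mem measurableSet_Ioi).mono fun s hs => gammaWeight_nonneg (le_of_lt hs)),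
    Real.Gamma_eq_integral (by positivity)]
  rfl

/-- Subordination of the Bessel potential to the heat semigroup, at the level of symbols. -/
theorem symbol_eq_integral (hd : 0 < d) (ξ : EuclideanSpace ℝ (Fin d)) :
    symbol d ξ = (((Real.Gamma ((d : ℝ) / 4))⁻¹ *
      ∫ s in Ioi (0 : ℝ), gammaWeight d s * heatSymbol d s ξ : ℝ) : ℂ) := by
  have hd4 : (0 : ℝ) < (d : ℝ) / 4 := by positivity
  set r : ℝ := 1 + (2 * Real.pi * ‖ξ‖) ^ 2 with hr
  have hr0 : 0 < r := by positivity
  have h1 : ∫ s in Ioi (0 : ℝ), gammaWeight d s * heatSymbol d s ξ =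
      (1 / r) ^ ((d : ℝ) / 4) * Real.Gamma ((d : ℝ) / 4) := by
    rw [← Real.integral_rpow_mul_exp_neg_mul_Ioi hd4 hr0]
    refine integral_congr_ae (Filter.Eventually.of_forall fun s => ?_)
    simp only [gammaWeight, heatSymbol]
    rw [mul_comm (Real.exp _), mul_assoc, ← Real.exp_add]
    congr 2
    rw [hr]
    ring
  have hG := (Real.Gamma_pos_of_pos hd4).ne'
  rw [h1, symbol, ← hr, one_div, Real.inv_rpow hr0.le, neg_div, Real.rpow_neg hr0.le]
  congr 1
  field_simp

theorem coeFn_toLp_symbol_smul (f : Lp ℂ 2 (volume : Measure (EuclideanSpace ℝ (Fin d)))) :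
    ((memLp_symbol d).toLp (symbol d) • f :
      Lp ℂ 2 (volume : Measure (EuclideanSpace ℝ (Fin d)))) =ᵐ[volume]
        fun ξ => symbol d ξ * f ξ := by
  rw [Lp.smul_def]
  filter_upwards [MemLp.coeFn_toLp ((Lp.memLp f).smul
    (Lp.memLp ((memLp_symbol d).toLp (symbol d))) (r := 2)), (memLp_symbol d).coeFn_toLp]
    with ξ h1 h2
  rw [h1, Pi.smul_apply', h2, smul_eq_mul]

open ComplexConjugate in
/-- The bilinear form of the Bessel potential is dominated by that of its convolution kernel, a
mixture of heat kernels. -/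
theorem norm_inner_besselPotential_le_of_integrable (hd : 0 < d)
    (f g : Lp ℂ 2 (volume : Measure (EuclideanSpace ℝ (Fin d))))
    (hf : Integrable f) (hg : Integrable g) :
    ENNReal.ofReal ‖inner ℂ g (besselPotential d f)‖ ≤
      ENNReal.ofReal (Real.Gamma ((d : ℝ) / 4))⁻¹ *
        ∫⁻ s in Ioi (0 : ℝ), ENNReal.ofReal (gammaWeight d s) *
          ∫⁻ v, ‖g v‖ₑ * ∫⁻ w, ‖f w‖ₑ * ENNReal.ofReal (heatKernel d s (v - w)) := by
  have hΓ : 0 < Real.Gamma ((d : ℝ) / 4) := Real.Gamma_pos_of_pos (by positivity)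
  set F : EuclideanSpace ℝ (Fin d) → ℂ := fun ξ => conj (𝓕 (g : _ → ℂ) ξ) * 𝓕 (f : _ → ℂ) ξ
    with hF
  have hFi : Integrable F := by
    refine (L2.integrable_inner (𝕜 := ℂ) (𝓕 g) (𝓕 f)).congr ?_
    filter_upwards [Lp_fourier_ae_eq f hf, Lp_fourier_ae_eq g hg] with ξ h1 h2
    rw [h1, h2, RCLike.inner_apply, mul_comm]
  have hsm : ((memLp_symbol d).toLp (symbol d) • 𝓕 f :
      Lp ℂ 2 (volume : Measure (EuclideanSpace ℝ (Fin d)))) =ᵐ[volume]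
        fun ξ => symbol d ξ * 𝓕 (f : _ → ℂ) ξ := by
    filter_upwards [coeFn_toLp_symbol_smul (𝓕 f), Lp_fourier_ae_eq f hf] with ξ h1 h2
    rw [h1, h2]
  have h1 : inner ℂ g (besselPotential d f) = ∫ ξ, F ξ * symbol d ξ := by
    rw [← Lp.inner_fourier_eq, besselPotential, FourierTransform.fourier_fourierInv_eq,
      L2.inner_def]
    refine integral_congr_ae ?_
    filter_upwards [hsm, Lp_fourier_ae_eq g hg] with ξ h1 h2
    rw [h1, h2, RCLike.inner_apply, hF]
    ring
  have hprod : Integrable (fun p : EuclideanSpace ℝ (Fin d) × ℝ =>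
      (heatSymbol d p.2 p.1 : ℂ) * (F p.1 * (gammaWeight d p.2 : ℂ)))
      (volume.prod (volume.restrict (Ioi 0))) := by
    refine (hFi.mul_prod (integrableOn_gammaWeight hd).ofReal).bdd_mul (c := 1)
      (Complex.measurable_ofReal.comp
        (measurable_heatSymbol.comp measurable_swap)).aestronglyMeasurable ?_
    have hae : ∀ᵐ p ∂((volume : Measure (EuclideanSpace ℝ (Fin d))).prod
        (volume.restrict (Ioi (0 : ℝ)))), p.2 ∈ Ioi (0 : ℝ) :=
      Measure.quasiMeasurePreserving_snd.ae (ae_restrict_mem measurableSet_Ioi)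
    filter_upwards [hae] with p hp
    have hp' : 0 < p.2 := hp
    rw [Complex.norm_real, heatSymbol, Real.norm_of_nonneg (Real.exp_pos _).le]
    exact Real.exp_le_one_iff.2 (neg_nonpos.2 (by positivity))
  have h2 : ∫ ξ, F ξ * symbol d ξ = ((Real.Gamma ((d : ℝ) / 4))⁻¹ : ℂ) *
      ∫ s in Ioi (0 : ℝ), (gammaWeight d s : ℂ) * ∫ ξ, F ξ * heatSymbol d s ξ := by
    calc ∫ ξ, F ξ * symbol d ξ
        = ((Real.Gamma ((d : ℝ) / 4))⁻¹ : ℂ) * ∫ ξ, ∫ s in Ioi (0 : ℝ),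
          (heatSymbol d s ξ : ℂ) * (F ξ * (gammaWeight d s : ℂ)) := by
          rw [← integral_const_mul]
          refine integral_congr_ae (Filter.Eventually.of_forall fun ξ => ?_)
          simp only
          rw [symbol_eq_integral hd, Complex.ofReal_mul, ← integral_complex_ofReal,
            Complex.ofReal_inv, mul_left_comm, ← integral_const_mul (F ξ)]
          congr 1
          refine integral_congr_ae (Filter.Eventually.of_forall fun s => ?_)
          simp only
          push_cast
          ring
      _ = _ := by
          rw [integral_integral_swap hprod]
          congr 1
          refine integral_congr_ae (Filter.Eventually.of_forall fun s => ?_)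
          simp only
          rw [← integral_const_mul]
          refine integral_congr_ae (Filter.Eventually.of_forall fun ξ => ?_)
          simp only
          ring
  rw [h1, h2, ofReal_norm, enorm_mul, ← Complex.ofReal_inv, ← ofReal_norm, Complex.norm_real,
    Real.norm_of_nonneg (inv_pos.2 hΓ).le]
  gcongr
  refine (enorm_integral_le_lintegral_enorm _).trans
    (setLIntegral_mono' measurableSet_Ioi fun s hs => ?_)
  rw [enorm_mul, ← ofReal_norm, Complex.norm_real,
    Real.norm_of_nonneg (gammaWeight_nonneg (le_of_lt hs))]
  gcongr
  rw [← ofReal_norm]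
  exact norm_integral_heatSymbol_le hs hf hg

theorem inner_besselPotential_comm (f g : Lp ℂ 2 (volume : Measure (EuclideanSpace ℝ (Fin d)))) :
    inner ℂ g (besselPotential d f) = inner ℂ (besselPotential d g) f := by
  rw [← Lp.inner_fourier_eq, besselPotential, FourierTransform.fourier_fourierInv_eq,
    ← Lp.inner_fourier_eq (besselPotential d g), besselPotential,
    FourierTransform.fourier_fourierInv_eq, L2.inner_def, L2.inner_def]
  refine integral_congr_ae ?_
  filter_upwards [coeFn_toLp_symbol_smul (𝓕 f), coeFn_toLp_symbol_smul (𝓕 g)] with ξ h1 h2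
  rw [h1, h2, RCLike.inner_apply, RCLike.inner_apply, map_mul, symbol, Complex.conj_ofReal]
  ring

/-- The kernel bound extends from `L₁ ∩ L₂` to `L₂` in the first argument, by truncation to
balls. -/
theorem norm_inner_besselPotential_le (hd : 0 < d)
    (f g : Lp ℂ 2 (volume : Measure (EuclideanSpace ℝ (Fin d)))) (hg : Integrable g) :
    ENNReal.ofReal ‖inner ℂ g (besselPotential d f)‖ ≤
      ENNReal.ofReal (Real.Gamma ((d : ℝ) / 4))⁻¹ *
        ∫⁻ s in Ioi (0 : ℝ), ENNReal.ofReal (gammaWeight d s) *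
          ∫⁻ v, ‖g v‖ₑ * ∫⁻ w, ‖f w‖ₑ * ENNReal.ofReal (heatKernel d s (v - w)) := by
  let A (n : ℕ) : Set (EuclideanSpace ℝ (Fin d)) := Metric.ball 0 n
  have hA (n : ℕ) : MeasurableSet (A n) := Metric.isOpen_ball.measurableSet
  have hU : ⋃ n, A n = univ := Metric.iUnion_ball_nat 0
  have hmono : Monotone A := fun m n h => Metric.ball_subset_ball (by exact_mod_cast h)
  let F : EuclideanSpace ℝ (Fin d) → ℂ := fun v => inner ℂ (besselPotential d g v) (f v)
  have hFi : Integrable F := L2.integrable_inner (𝕜 := ℂ) (besselPotential d g) f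
  have hlim := tendsto_setIntegral_of_monotone (μ := volume) hA hmono (f := F)
    hFi.integrableOn
  rw [hU, setIntegral_univ] at hlim
  have hlim2 : Filter.Tendsto (fun n => ENNReal.ofReal ‖∫ v in A n, F v‖) Filter.atTop
      (nhds (ENNReal.ofReal ‖∫ v, F v‖)) :=
    (ENNReal.continuous_ofReal.tendsto _).comp hlim.norm
  rw [inner_besselPotential_comm, L2.inner_def]
  refine le_of_tendsto' hlim2 fun n => ?_
  have hfn : MemLp ((A n).indicator f) 2 volume := (Lp.memLp f).indicator (hA n)
  have hae := hfn.coeFn_toLp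
  have hfi : Integrable (hfn.toLp _) := by
    refine Integrable.congr ?_ hae.symm
    rw [integrable_indicator_iff (hA n)]
    have : IsFiniteMeasure (volume.restrict (A n)) :=
      ⟨by rw [Measure.restrict_apply_univ]; exact measure_ball_lt_top⟩
    exact ((Lp.memLp f).restrict (A n)).integrable (by norm_num)
  have h1 : ∫ v in A n, F v = inner ℂ g (besselPotential d (hfn.toLp _)) := by
    rw [inner_besselPotential_comm, L2.inner_def, ← integral_indicator (hA n)]
    refine integral_congr_ae ?_
    filter_upwards [hae] with v hv
    rw [hv]
    by_cases h : v ∈ A n <;> simp [h, F]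
  rw [h1]
  refine (norm_inner_besselPotential_le_of_integrable hd _ g hfi hg).trans ?_
  refine mul_le_mul_right (lintegral_mono fun s => mul_le_mul_right
    (lintegral_mono fun v => mul_le_mul_right ?_ _) _) _
  refine lintegral_mono_ae ?_
  filter_upwards [hae] with w hw
  rw [hw]
  gcongr
  exact enorm_indicator_le_enorm_self _ _

end Bessel

/-! ### Estimates for weights under the heat semigroup -/

section WeightEstimate

variable {d : ℕ}

/-- Let `K` be a doubly substochastic kernel bounded by `1 / u`. If the weight `0 ≤ h ≤ 1` has mass
at most `t`, then `K h` has mass at most `t` and is bounded by `min(1, t / u) = t / max(t, u)`, and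
the Hardy-Littlewood inequality bounds its pairing with `f`. -/
theorem lintegral_weight_mul_kernel_le {α E : Type*} [MeasurableSpace α] [NormedAddCommGroup E]
    {ν : Measure α} [SFinite ν] {f : α → E} (hf : StronglyMeasurable f) (hft : HasSmallTails ν f)
    {K : α → α → ℝ≥0∞} (hK : Measurable (Function.uncurry K))
    (hK1 : ∀ w, ∫⁻ v, K v w ∂ν ≤ 1) (hK2 : ∀ v, ∫⁻ w, K v w ∂ν ≤ 1)
    {u : ℝ} (hKu : ∀ v w, K v w ≤ ENNReal.ofReal u⁻¹)
    {h : α → ℝ≥0∞} (hh : Measurable h) (hh1 : ∀ v, h v ≤ 1)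
    {t : ℝ} (ht : 0 < t) (hht : ∫⁻ v, h v ∂ν ≤ ENNReal.ofReal t) :
    ∫⁻ v, h v * ∫⁻ w, ‖f w‖ₑ * K v w ∂ν ∂ν ≤ ENNReal.ofReal (t / max t u) *
        ∫⁻ r in Ioo 0 (max t u), ENNReal.ofReal (rearrangement ν f r) := by
  have hm0 : 0 < max t u := lt_max_of_lt_left ht
  have hKv (v : α) : Measurable fun w => K v w := hK.comp measurable_prodMk_left
  have hKw (w : α) : Measurable fun v => K v w := hK.comp measurable_prodMk_right
  have hfe : Measurable fun w => ‖f w‖ₑ := hf.enorm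
  have hhK : Measurable fun p : α × α => h p.1 * K p.1 p.2 := (hh.comp measurable_fst).mul hK
  let k : α → ℝ≥0∞ := fun w => ∫⁻ v, h v * K v w ∂ν
  have hk : Measurable k := hhK.lintegral_prod_left'
  have hswap : ∫⁻ v, h v * ∫⁻ w, ‖f w‖ₑ * K v w ∂ν ∂ν = ∫⁻ w, ‖f w‖ₑ * k w ∂ν := by
    calc ∫⁻ v, h v * ∫⁻ w, ‖f w‖ₑ * K v w ∂ν ∂ν
        = ∫⁻ v, ∫⁻ w, ‖f w‖ₑ * (h v * K v w) ∂ν ∂ν := by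
          refine lintegral_congr fun v => ?_
          exact (lintegral_const_mul (h v) (hfe.mul (hKv v))).symm.trans
            (lintegral_congr fun w => mul_left_comm _ _ _)
      _ = ∫⁻ w, ∫⁻ v, ‖f w‖ₑ * (h v * K v w) ∂ν ∂ν :=
          lintegral_lintegral_swap ((hfe.comp measurable_snd).mul hhK).aemeasurable
      _ = _ := lintegral_congr fun w => lintegral_const_mul _ (hh.mul (hKw w))
  have hkM (w : α) : k w ≤ ENNReal.ofReal (t / max t u) := by
    rcases le_total u t with hut | hut
    · rw [max_eq_left hut, div_self ht.ne', ENNReal.ofReal_one]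
      exact (lintegral_mono fun v => mul_le_of_le_one_left' (hh1 v)).trans (hK1 w)
    · rw [max_eq_right hut, div_eq_mul_inv, ENNReal.ofReal_mul ht.le]
      calc k w ≤ ∫⁻ v, h v * ENNReal.ofReal u⁻¹ ∂ν :=
            lintegral_mono fun v => mul_le_mul_right (hKu v w) _
        _ = (∫⁻ v, h v ∂ν) * ENNReal.ofReal u⁻¹ := lintegral_mul_const _ hh
        _ ≤ _ := by gcongr
  have hkt : ∫⁻ w, k w ∂ν ≤ ENNReal.ofReal t := by
    calc ∫⁻ w, k w ∂ν = ∫⁻ v, ∫⁻ w, h v * K v w ∂ν ∂ν :=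
          lintegral_lintegral_swap (hhK.comp measurable_swap).aemeasurable
      _ = ∫⁻ v, h v * ∫⁻ w, K v w ∂ν ∂ν :=
          lintegral_congr fun v => lintegral_const_mul _ (hKv v)
      _ ≤ ∫⁻ v, h v ∂ν := lintegral_mono fun v => mul_le_of_le_one_right' (hK2 v)
      _ ≤ _ := hht
  rw [hswap]
  have := lintegral_enorm_mul_le hft hf hk (div_pos ht hm0) hkM hkt
  rwa [div_div_cancel₀ ht.ne'] at this

theorem lintegral_weight_mul_heat_le {f : EuclideanSpace ℝ (Fin d) → ℂ}
    (hf : StronglyMeasurable f) (hft : HasSmallTails volume f)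
    {h : EuclideanSpace ℝ (Fin d) → ℝ≥0∞} (hh : Measurable h) (hh1 : ∀ v, h v ≤ 1)
    {t : ℝ} (ht : 0 < t) (hht : ∫⁻ v, h v ≤ ENNReal.ofReal t) {s : ℝ} (hs : 0 < s) :
    ∫⁻ v, h v * ∫⁻ w, ‖f w‖ₑ * ENNReal.ofReal (heatKernel d s (v - w)) ≤
      ENNReal.ofReal (t / max t ((4 * Real.pi * s) ^ ((d : ℝ) / 2))) *
        ∫⁻ r in Ioo 0 (max t ((4 * Real.pi * s) ^ ((d : ℝ) / 2))),
          ENNReal.ofReal (rearrangement volume f r) := by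
  have hone (w : EuclideanSpace ℝ (Fin d)) :
      ∫⁻ v, ENNReal.ofReal (heatKernel d s (v - w)) = 1 := by
    rw [lintegral_sub_right_eq_self (fun v => ENNReal.ofReal (heatKernel d s v)) w,
      lintegral_heatKernel hs]
  refine lintegral_weight_mul_kernel_le hf hft
    (K := fun v w => ENNReal.ofReal (heatKernel d s (v - w))) ?_ (fun w => (hone w).le)
    (fun v => ?_) (fun v w => ENNReal.ofReal_le_ofReal (heatKernel_le hs _)) hh hh1 ht hht
  · exact (measurable_heatKernel.comp (measurable_const.prodMk
      (measurable_fst.sub measurable_snd))).ennreal_ofReal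
  · simp only [heatKernel_sub_comm s v]
    exact (hone v).le

/-- For `t ≤ 1` the part of a decreasing `φ` beyond `1` is controlled by its integral over
`(0, 1)`. -/
theorem ofReal_div_mul_lintegral_le {φ : ℝ → ℝ≥0∞} (hφ : AntitoneOn φ (Ioi 0)) {t : ℝ}
    (ht : 0 < t) (u : ℝ) :
    ENNReal.ofReal (t / max t u) * ∫⁻ r in Ioo 0 (max t u), φ r ≤
      ENNReal.ofReal t * ((∫⁻ r in Ioo (0 : ℝ) 1, ENNReal.ofReal (max (max t r) u)⁻¹ * φ r) +
        ∫⁻ r in Ioo (0 : ℝ) 1, φ r) := by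
  set m := max t u with hm
  have hm0 : 0 < m := lt_max_of_lt_left ht
  set A := ∫⁻ r in Ioo (0 : ℝ) 1, φ r
  have hsub : Ioo 0 m ⊆ (Iio m ∩ Ioo 0 1) ∪ Ico 1 m := fun r hr => by
    rcases lt_or_ge r 1 with h | h
    · exact Or.inl ⟨hr.2, hr.1, h⟩
    · exact Or.inr ⟨h, hr.2⟩
  have hφA (r : ℝ) (hr : 1 ≤ r) : φ r ≤ A := by
    calc φ r = ∫⁻ _ in Ioo (0 : ℝ) 1, φ r := by simp
      _ ≤ A := setLIntegral_mono' measurableSet_Ioo fun s hs =>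
          hφ hs.1 (zero_lt_one.trans_le hr : (0 : ℝ) < r) (hs.2.le.trans hr)
  have h2 : ∫⁻ r in Ico 1 m, φ r ≤ ENNReal.ofReal m * A := by
    calc ∫⁻ r in Ico 1 m, φ r ≤ ∫⁻ _ in Ico 1 m, A :=
          setLIntegral_mono' measurableSet_Ico fun r hr => hφA r hr.1
      _ = A * ENNReal.ofReal (m - 1) := by simp
      _ ≤ ENNReal.ofReal m * A := by
          rw [mul_comm]
          gcongr
          linarith
  have h1 : ENNReal.ofReal (t / m) * ∫⁻ r in Iio m ∩ Ioo 0 1, φ r ≤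
      ENNReal.ofReal t * ∫⁻ r in Ioo (0 : ℝ) 1, ENNReal.ofReal (max (max t r) u)⁻¹ * φ r := by
    rw [← lintegral_const_mul' _ _ ENNReal.ofReal_ne_top,
      ← lintegral_const_mul' _ _ ENNReal.ofReal_ne_top]
    calc ∫⁻ r in Iio m ∩ Ioo 0 1, ENNReal.ofReal (t / m) * φ r
        ≤ ∫⁻ r in Iio m ∩ Ioo 0 1,
          ENNReal.ofReal t * (ENNReal.ofReal (max (max t r) u)⁻¹ * φ r) := by
          refine setLIntegral_mono' (measurableSet_Iio.inter measurableSet_Ioo) fun r hr => ?_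
          have : max (max t r) u = m := by
            rw [max_right_comm, ← hm, max_eq_left (le_of_lt hr.1)]
          rw [this, ← mul_assoc, ← ENNReal.ofReal_mul ht.le, div_eq_mul_inv]
      _ ≤ _ := lintegral_mono_set inter_subset_right
  calc ENNReal.ofReal (t / m) * ∫⁻ r in Ioo 0 m, φ r
      ≤ ENNReal.ofReal (t / m) * ((∫⁻ r in Iio m ∩ Ioo 0 1, φ r) + ∫⁻ r in Ico 1 m, φ r) := by
        gcongr
        exact (lintegral_mono_set hsub).trans (lintegral_union_le _ _ _)
    _ ≤ ENNReal.ofReal t * (∫⁻ r in Ioo (0 : ℝ) 1, ENNReal.ofReal (max (max t r) u)⁻¹ * φ r) +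
          ENNReal.ofReal (t / m) * (ENNReal.ofReal m * A) := by
        rw [mul_add]
        gcongr
    _ = _ := by
        rw [← mul_assoc, ← ENNReal.ofReal_mul (by positivity), div_mul_cancel₀ _ hm0.ne', mul_add]

/-- The constant `2 (4/d) (4π)^(-d/4)`, twice the value at `ρ = 1` of each of the two power
integrals to which `∫ s^(d/4-1) min(1/ρ, (4πs)^(-d/2)) ds` reduces. -/
noncomputable def scaleConst (d : ℕ) : ℝ :=
  2 * ((4 * Real.pi) ^ (-((d : ℝ) / 4)) / ((d : ℝ) / 4))

theorem scaleConst_nonneg : 0 ≤ scaleConst d := by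
  unfold scaleConst
  positivity

/-- The size `ρ^(-1/2)` of the Bessel kernel at distances `v` with `|v|^d` comparable to `ρ`,
expressed through the heat semigroup. -/
theorem lintegral_gammaWeight_mul_le (hd : 0 < d) {ρ : ℝ} (hρ : 0 < ρ) :
    ∫⁻ s in Ioi (0 : ℝ), ENNReal.ofReal (gammaWeight d s) *
        ENNReal.ofReal (max ρ ((4 * Real.pi * s) ^ ((d : ℝ) / 2)))⁻¹ ≤
      ENNReal.ofReal (scaleConst d * ρ ^ (-(1 / 2) : ℝ)) := by
  have hπ : 0 < 4 * Real.pi := by positivity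
  set a : ℝ := (d : ℝ) / 4 with ha
  have ha0 : 0 < a := by positivity
  have hda : (d : ℝ) / 2 = 2 * a := by rw [ha]; ring
  rw [hda]
  -- the time at which the on-diagonal size of the heat kernel is `1 / ρ`
  set σ : ℝ := ρ ^ (1 / (2 * a)) / (4 * Real.pi) with hσ
  have hσ0 : 0 < σ := by positivity
  have hσa : σ ^ a = ρ ^ (1 / 2 : ℝ) * (4 * Real.pi) ^ (-a) := by
    rw [hσ, Real.div_rpow (by positivity) hπ.le, ← Real.rpow_mul hρ.le, Real.rpow_neg hπ.le,
      div_eq_mul_inv]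
    congr 2
    field_simp
  have hσa' : σ ^ (-a) = ρ ^ (-(1 / 2) : ℝ) * (4 * Real.pi) ^ a := by
    rw [Real.rpow_neg hσ0.le, hσa, mul_inv, ← Real.rpow_neg hρ.le, ← Real.rpow_neg hπ.le, neg_neg]
  have hw {s : ℝ} (hs : 0 < s) : gammaWeight d s ≤ s ^ (a - 1) :=
    mul_le_of_le_one_left (by positivity) (Real.exp_le_one_iff.2 (by linarith))
  have h1 : ∫⁻ s in Ioc 0 σ, ENNReal.ofReal (gammaWeight d s) *
        ENNReal.ofReal (max ρ ((4 * Real.pi * s) ^ (2 * a)))⁻¹ ≤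
      ENNReal.ofReal ((4 * Real.pi) ^ (-a) / a * ρ ^ (-(1 / 2) : ℝ)) := by
    have hint : IntegrableOn (fun s : ℝ => s ^ (a - 1) * ρ⁻¹) (Ioc 0 σ) := by
      refine Integrable.mul_const ?_ _
      rw [← IntegrableOn, ← intervalIntegrable_iff_integrableOn_Ioc_of_le hσ0.le]
      exact intervalIntegral.intervalIntegrable_rpow' (by linarith)
    calc _ ≤ ∫⁻ s in Ioc 0 σ, ENNReal.ofReal (s ^ (a - 1) * ρ⁻¹) := by
          refine setLIntegral_mono' measurableSet_Ioc fun s hs => ?_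
          rw [← ENNReal.ofReal_mul (gammaWeight_nonneg hs.1.le)]
          have := hs.1
          refine ENNReal.ofReal_le_ofReal ?_
          gcongr
          · exact hw hs.1
          · exact le_max_left _ _
      _ = ENNReal.ofReal ((4 * Real.pi) ^ (-a) / a * ρ ^ (-(1 / 2) : ℝ)) := by
          rw [← ofReal_integral_eq_lintegral_ofReal hint
            ((ae_restrict_mem measurableSet_Ioc).mono fun s hs => by have := hs.1; positivity),
            integral_mul_const, ← intervalIntegral.integral_of_le hσ0.le,
            integral_rpow (Or.inl (by linarith)), sub_add_cancel, Real.zero_rpow ha0.ne', sub_zero,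
            hσa]
          congr 1
          have : ρ ^ (1 / 2 : ℝ) * ρ⁻¹ = ρ ^ (-(1 / 2) : ℝ) := by
            rw [← Real.rpow_neg_one, ← Real.rpow_add hρ]
            norm_num
          rw [← this]
          ring
  have h2 : ∫⁻ s in Ioi σ, ENNReal.ofReal (gammaWeight d s) *
        ENNReal.ofReal (max ρ ((4 * Real.pi * s) ^ (2 * a)))⁻¹ ≤
      ENNReal.ofReal ((4 * Real.pi) ^ (-a) / a * ρ ^ (-(1 / 2) : ℝ)) := by
    have hint : IntegrableOn (fun s : ℝ => (4 * Real.pi) ^ (-(2 * a)) * s ^ (-a - 1)) (Ioi σ) :=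
      (integrableOn_Ioi_rpow_of_lt (by linarith) hσ0).const_mul _
    calc _ ≤ ∫⁻ s in Ioi σ, ENNReal.ofReal ((4 * Real.pi) ^ (-(2 * a)) * s ^ (-a - 1)) := by
          refine setLIntegral_mono' measurableSet_Ioi fun s hs => ?_
          have hs0 : 0 < s := hσ0.trans hs
          rw [← ENNReal.ofReal_mul (gammaWeight_nonneg hs0.le)]
          refine ENNReal.ofReal_le_ofReal ?_
          have h3 : s ^ (a - 1) * ((4 * Real.pi * s) ^ (2 * a))⁻¹ =
              (4 * Real.pi) ^ (-(2 * a)) * s ^ (-a - 1) := by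
            rw [← Real.rpow_neg (by positivity), Real.mul_rpow hπ.le hs0.le, mul_left_comm,
              ← Real.rpow_add hs0]
            congr 2
            ring
          rw [← h3]
          gcongr
          · exact hw hs0
          · exact le_max_right _ _
      _ = ENNReal.ofReal ((4 * Real.pi) ^ (-a) / a * ρ ^ (-(1 / 2) : ℝ)) := by
          rw [← ofReal_integral_eq_lintegral_ofReal hint
            ((ae_restrict_mem measurableSet_Ioi).mono fun s hs => by
              have : 0 < s := hσ0.trans hs
              positivity),
            integral_const_mul, integral_Ioi_rpow_of_lt (by linarith) hσ0, sub_add_cancel, hσa',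
            show -(2 * a) = -a + -a by ring, Real.rpow_add hπ]
          congr 1
          have : (4 * Real.pi) ^ (-a) * (4 * Real.pi) ^ a = 1 := by
            rw [← Real.rpow_add hπ, neg_add_cancel, Real.rpow_zero]
          rw [neg_div_neg_eq]
          linear_combination ((4 * Real.pi) ^ (-a) / a * ρ ^ (-(1 / 2) : ℝ)) * this
  rw [← Ioc_union_Ioi_eq_Ioi hσ0.le]
  refine (lintegral_union_le _ _ _).trans ((add_le_add h1 h2).trans (le_of_eq ?_))
  rw [← ENNReal.ofReal_add (by positivity) (by positivity), scaleConst]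
  congr 1
  ring

end WeightEstimate

/-! ### The bound for the averaged rearrangement of the Bessel potential -/

section PointwiseBound

variable {d : ℕ}

open ComplexConjugate in
/-- The inner products against unimodular multiples of weights recover the `L₁` pairings. -/
theorem exists_inner_eq_lintegral {α : Type*} [MeasurableSpace α] {ν : Measure α} (y : Lp ℂ 2 ν)
    {h : α → ℝ≥0∞} (hh : Measurable h) (hh1 : ∀ a, h a ≤ 1) (hhi : ∫⁻ a, h a ∂ν ≠ ∞) :
    ∃ g : Lp ℂ 2 ν, Integrable g ν ∧ (∀ᵐ a ∂ν, ‖g a‖ₑ ≤ h a) ∧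
      ∫⁻ a, ‖y a‖ₑ * h a ∂ν = ENNReal.ofReal ‖inner ℂ g y‖ := by
  let G : α → ℂ := fun a => y a / ‖y a‖ * (h a).toReal
  have hym : Measurable y := (Lp.stronglyMeasurable y).measurable
  have hGm : Measurable G :=
    (hym.div (Complex.measurable_ofReal.comp hym.norm)).mul
      (Complex.measurable_ofReal.comp hh.ennreal_toReal)
  have htop (a : α) : h a ≠ ∞ := ((hh1 a).trans_lt ENNReal.one_lt_top).ne
  have hh1' (a : α) : (h a).toReal ≤ 1 :=
    ENNReal.toReal_le_of_le_ofReal zero_le_one (by simpa using hh1 a)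
  have hGn (a : α) : ‖G a‖ ≤ (h a).toReal := by
    simp only [G, norm_mul, norm_div, Complex.norm_real, norm_norm,
      Real.norm_of_nonneg ENNReal.toReal_nonneg]
    exact mul_le_of_le_one_left ENNReal.toReal_nonneg (div_self_le_one _)
  have hGi : Integrable G ν :=
    (integrable_toReal_of_lintegral_ne_top hh.aemeasurable hhi).mono' hGm.aestronglyMeasurable
      (Filter.Eventually.of_forall hGn)
  have hG2 : MemLp G 2 ν := by
    rw [memLp_two_iff_integrable_sq_norm hGm.aestronglyMeasurable]
    refine hGi.norm.mono' (hGm.norm.pow_const 2).aestronglyMeasurable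
      (Filter.Eventually.of_forall fun a => ?_)
    rw [norm_pow, norm_norm]
    exact pow_le_of_le_one (norm_nonneg _) ((hGn a).trans (hh1' a)) two_ne_zero
  have hae := hG2.coeFn_toLp
  refine ⟨hG2.toLp G, hGi.congr hae.symm, ?_, ?_⟩
  · filter_upwards [hae] with a ha
    rw [ha, ← ofReal_norm, ← ENNReal.ofReal_toReal (htop a)]
    exact ENNReal.ofReal_le_ofReal (hGn a)
  · have hpt : ∀ᵐ a ∂ν, inner ℂ (hG2.toLp G a) (y a) = ((‖y a‖ * (h a).toReal : ℝ) : ℂ) := by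
      filter_upwards [hae] with a ha
      rw [ha, RCLike.inner_apply]
      simp only [G, map_mul, map_div₀, Complex.conj_ofReal]
      rw [← mul_assoc, ← mul_div_assoc, Complex.mul_conj, Complex.normSq_eq_norm_sq]
      push_cast
      rcases eq_or_ne ‖y a‖ 0 with h0 | h0
      · simp [h0]
      · have : (‖y a‖ : ℂ) ≠ 0 := by exact_mod_cast h0
        field_simp
    have hint : Integrable (fun a => ‖y a‖ * (h a).toReal) ν := by
      refine ((L2.integrable_inner (𝕜 := ℂ) (hG2.toLp G) y).congr hpt).re.congr
        (Filter.Eventually.of_forall fun a => ?_)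
      simp
    rw [L2.inner_def, integral_congr_ae hpt, integral_complex_ofReal, Complex.norm_real,
      Real.norm_of_nonneg (integral_nonneg fun a => by positivity),
      ofReal_integral_eq_lintegral_ofReal hint
        (Filter.Eventually.of_forall fun a => by positivity)]
    refine lintegral_congr fun a => ?_
    rw [ENNReal.ofReal_mul (norm_nonneg _), ofReal_norm, ENNReal.ofReal_toReal (htop a)]

/-- The constant in the submajorization. -/
noncomputable def besselConst (d : ℕ) : ℝ :=
  (Real.Gamma ((d : ℝ) / 4))⁻¹ * (scaleConst d + Real.Gamma ((d : ℝ) / 4))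

theorem besselConst_pos (hd : 0 < d) : 0 < besselConst d := by
  have hΓ : 0 < Real.Gamma ((d : ℝ) / 4) := Real.Gamma_pos_of_pos (by positivity)
  have := scaleConst_nonneg (d := d)
  unfold besselConst
  positivity

/-- Integration in the heat time of the bounds for the heat semigroup. -/
theorem lintegral_gammaWeight_mul_lintegral_le (hd : 0 < d) {φ : ℝ → ℝ≥0∞}
    (hφ : AntitoneOn φ (Ioi 0)) {t : ℝ} (ht : 0 < t) (ht1 : t ≤ 1) :
    ∫⁻ s in Ioi (0 : ℝ), ENNReal.ofReal (gammaWeight d s) *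
        (ENNReal.ofReal (t / max t ((4 * Real.pi * s) ^ ((d : ℝ) / 2))) *
          ∫⁻ r in Ioo 0 (max t ((4 * Real.pi * s) ^ ((d : ℝ) / 2))), φ r) ≤
      ENNReal.ofReal (scaleConst d + Real.Gamma ((d : ℝ) / 4)) * (ENNReal.ofReal t *
        ∫⁻ r in Ioo (0 : ℝ) 1, ENNReal.ofReal (max t r ^ (-(1 / 2) : ℝ)) * φ r) := by
  have hΓ : 0 < Real.Gamma ((d : ℝ) / 4) := Real.Gamma_pos_of_pos (by positivity)
  set A := ∫⁻ r in Ioo (0 : ℝ) 1, φ r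
  set S := ∫⁻ r in Ioo (0 : ℝ) 1, ENNReal.ofReal (max t r ^ (-(1 / 2) : ℝ)) * φ r with hS
  let u : ℝ → ℝ := fun s => (4 * Real.pi * s) ^ ((d : ℝ) / 2)
  have hum : Measurable u := by fun_prop
  let w : ℝ → ℝ≥0∞ := fun s => ENNReal.ofReal (gammaWeight d s)
  have hwm : Measurable w := measurable_gammaWeight.ennreal_ofReal
  have hφm : AEMeasurable φ (volume.restrict (Ioo 0 1)) :=
    aemeasurable_restrict_of_antitoneOn measurableSet_Ioo (hφ.mono Ioo_subset_Ioi_self)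
  have hAS : A ≤ S := by
    refine setLIntegral_mono' measurableSet_Ioo fun r hr => ?_
    have h0 : 0 < max t r := lt_max_of_lt_left ht
    have : 1 ≤ max t r ^ (-(1 / 2) : ℝ) :=
      Real.one_le_rpow_of_pos_of_le_one_of_nonpos h0 (max_le ht1 hr.2.le) (by norm_num)
    exact le_mul_of_one_le_left' (ENNReal.one_le_ofReal.2 this)
  let m : ℝ → ℝ → ℝ≥0∞ := fun s r => ENNReal.ofReal (max (max t r) (u s))⁻¹
  have hmm : Measurable (Function.uncurry m) :=
    (((measurable_const.max measurable_snd).max (hum.comp measurable_fst)).inv).ennreal_ofReal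
  have hswap : ∫⁻ s in Ioi (0 : ℝ), w s * ∫⁻ r in Ioo (0 : ℝ) 1, m s r * φ r =
      ∫⁻ r in Ioo (0 : ℝ) 1, (∫⁻ s in Ioi (0 : ℝ), w s * m s r) * φ r := by
    have hmr (r : ℝ) : Measurable fun s => m s r := hmm.comp measurable_prodMk_right
    calc ∫⁻ s in Ioi (0 : ℝ), w s * ∫⁻ r in Ioo (0 : ℝ) 1, m s r * φ r
        = ∫⁻ s in Ioi (0 : ℝ), ∫⁻ r in Ioo (0 : ℝ) 1, w s * m s r * φ r := by
          refine lintegral_congr fun s => ?_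
          rw [← lintegral_const_mul' _ _ ENNReal.ofReal_ne_top]
          exact lintegral_congr fun r => (mul_assoc _ _ _).symm
      _ = ∫⁻ r in Ioo (0 : ℝ) 1, ∫⁻ s in Ioi (0 : ℝ), w s * m s r * φ r :=
          lintegral_lintegral_swap
            ((((hwm.comp measurable_fst).mul hmm).aemeasurable).mul hφm.comp_snd)
      _ = _ := lintegral_congr fun r => lintegral_mul_const _ (hwm.mul (hmr r))
  calc _ ≤ ∫⁻ s in Ioi (0 : ℝ), ENNReal.ofReal t *
          (w s * (∫⁻ r in Ioo (0 : ℝ) 1, m s r * φ r) + w s * A) := by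
        refine lintegral_mono fun s => ?_
        rw [← mul_add]
        exact (mul_le_mul_right (ofReal_div_mul_lintegral_le hφ ht (u s)) (w s)).trans_eq
          (mul_left_comm _ _ _)
    _ = ENNReal.ofReal t * ((∫⁻ r in Ioo (0 : ℝ) 1, (∫⁻ s in Ioi (0 : ℝ), w s * m s r) * φ r) +
          ENNReal.ofReal (Real.Gamma ((d : ℝ) / 4)) * A) := by
        rw [lintegral_const_mul' _ _ ENNReal.ofReal_ne_top,
          lintegral_add_right _ (hwm.mul_const A), hswap, lintegral_mul_const _ hwm,
          lintegral_gammaWeight hd]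
    _ ≤ ENNReal.ofReal t * (ENNReal.ofReal (scaleConst d) * S +
          ENNReal.ofReal (Real.Gamma ((d : ℝ) / 4)) * S) := by
        gcongr
        rw [hS, ← lintegral_const_mul' _ _ ENNReal.ofReal_ne_top]
        refine lintegral_mono fun r => ?_
        rw [← mul_assoc, ← ENNReal.ofReal_mul scaleConst_nonneg]
        exact mul_le_mul_left (lintegral_gammaWeight_mul_le hd (lt_max_of_lt_left ht)) _
    _ = _ := by
        rw [← add_mul, ← ENNReal.ofReal_add scaleConst_nonneg hΓ.le, mul_left_comm]

/-- O'Neil-type bound: the averaged rearrangement of `(1 - Δ)^(-d/4) f` at `t ≤ 1` is at most a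
constant times the Hardy-type operator applied to the rearrangement of `f`. -/
theorem lintegral_rearrangement_besselPotential_le (hd : 0 < d)
    (f : Lp ℂ 2 (volume : Measure (EuclideanSpace ℝ (Fin d)))) {t : ℝ} (ht : 0 < t)
    (ht1 : t ≤ 1) :
    ∫⁻ r in Ioo 0 t, ENNReal.ofReal (rearrangement volume (besselPotential d f) r) ≤
      ENNReal.ofReal (besselConst d) * (ENNReal.ofReal t *
        ∫⁻ r in Ioo (0 : ℝ) 1, ENNReal.ofReal (max t r ^ (-(1 / 2) : ℝ)) *
          ENNReal.ofReal (rearrangement volume f r)) := by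
  have hΓ : 0 < Real.Gamma ((d : ℝ) / 4) := Real.Gamma_pos_of_pos (by positivity)
  set y := besselPotential d f
  have hf := hasSmallTails_of_memLp_two (Lp.memLp f)
  obtain ⟨h, hh, hh1, hht, hle⟩ := exists_weight_lintegral_rearrangement_le
    (Lp.stronglyMeasurable y)
    (fun s hs => ((meas_lt_norm_le_of_memLp_two (Lp.memLp y) hs).trans_lt
      ENNReal.ofReal_lt_top).ne) (hasSmallTails_of_memLp_two (Lp.memLp y)) ht
  obtain ⟨g, hgi, hgh, hgy⟩ := exists_inner_eq_lintegral y hh hh1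
    (hht.trans_lt ENNReal.ofReal_lt_top).ne
  have hφ : AntitoneOn (fun r => ENNReal.ofReal (rearrangement volume f r)) (Ioi 0) :=
    fun r hr s hs hrs => ENNReal.ofReal_le_ofReal (antitoneOn_rearrangement hf hr hs hrs)
  refine hle.trans (hgy.trans_le ((norm_inner_besselPotential_le hd f g hgi).trans ?_))
  rw [besselConst, ENNReal.ofReal_mul (inv_pos.2 hΓ).le, mul_assoc]
  refine mul_le_mul_right ?_ _
  refine le_trans (setLIntegral_mono' measurableSet_Ioi fun s hs => mul_le_mul_right ?_ _)
    (lintegral_gammaWeight_mul_lintegral_le hd hφ ht ht1)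
  refine le_trans (lintegral_mono_ae ?_)
    (lintegral_weight_mul_heat_le (Lp.stronglyMeasurable f) hf hh hh1 ht hht hs)
  filter_upwards [hgh] with v hv
  exact mul_le_mul_left hv _

end PointwiseBound

/-! ### The Hardy-type operator -/

section Hardy

variable {φ : ℝ → ℝ}

/-- The kernel form of the Hardy-type operator. In contrast to `hardyT` it is not cut off
outside `(0, 1)`, so that it can be used at the endpoint `t = 1`. -/
noncomputable def hardyKernelT (φ : ℝ → ℝ) (t : ℝ) : ℝ :=
  ∫ r in Ioo (0 : ℝ) 1, max t r ^ (-(1 / 2) : ℝ) * φ r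

theorem integrableOn_hardyKernelT (hφ : IntegrableOn φ (Ioo 0 1)) {t : ℝ} (ht : 0 < t) :
    IntegrableOn (fun r => max t r ^ (-(1 / 2) : ℝ) * φ r) (Ioo 0 1) := by
  have hmeas : Measurable fun r : ℝ => max t r ^ (-(1 / 2) : ℝ) := by fun_prop
  refine Integrable.bdd_mul (c := t ^ (-(1 / 2) : ℝ)) hφ hmeas.aestronglyMeasurable
    (Filter.Eventually.of_forall fun r => ?_)
  have : 0 < max t r := lt_max_of_lt_left ht
  rw [Real.norm_of_nonneg (by positivity)]
  exact Real.rpow_le_rpow_of_nonpos ht (le_max_left _ _) (by norm_num)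

/-- On a function supported in `(0, 1)` the Hardy-type operator has the kernel
`max(t, r)^(-1/2)`, so it is decreasing if `φ ≥ 0`. -/
theorem hardyT_indicator_eq (hφ : IntegrableOn φ (Ioo 0 1)) {t : ℝ} (ht : t ∈ Ioo (0 : ℝ) 1) :
    hardyT ((Ioo (0 : ℝ) 1).indicator φ) t = hardyKernelT φ t := by
  have hsplit : Ioo (0 : ℝ) 1 = Ioc 0 t ∪ Ioo t 1 := (Ioc_union_Ioo_eq_Ioo ht.1.le ht.2).symm
  have hdisj : Disjoint (Ioc 0 t) (Ioo t 1) :=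
    Set.disjoint_left.2 fun r h1 h2 => absurd h2.1 (not_lt.2 h1.2)
  have hint := integrableOn_hardyKernelT hφ ht.1
  rw [hsplit] at hint
  rw [hardyT, hardyKernelT, indicator_of_mem ht, hsplit, setIntegral_union hdisj measurableSet_Ioo
    (hint.mono_set subset_union_left) (hint.mono_set subset_union_right),
    intervalIntegral.integral_of_le ht.1.le, intervalIntegral.integral_of_le ht.2.le,
    ← integral_const_mul, integral_Ioc_eq_integral_Ioo (x := t)]
  congr 1
  · refine setIntegral_congr_fun measurableSet_Ioc fun r hr => ?_
    have : r ∈ Ioc (0 : ℝ) t ∪ Ioo t 1 := Or.inl hr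
    simp only [indicator_of_mem this, max_eq_left hr.2]
  · refine setIntegral_congr_fun measurableSet_Ioo fun r hr => ?_
    have h0 : 0 < r := ht.1.trans hr.1
    have : r ∈ Ioc (0 : ℝ) t ∪ Ioo t 1 := Or.inr hr
    simp only [indicator_of_mem this, max_eq_right hr.1.le]
    rw [Real.rpow_neg h0.le, div_eq_mul_inv, mul_comm]

theorem hardyKernelT_nonneg (hφ0 : 0 ≤ φ) {t : ℝ} (ht : 0 < t) : 0 ≤ hardyKernelT φ t := by
  refine integral_nonneg fun r => ?_
  have : 0 < max t r := lt_max_of_lt_left ht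
  have := hφ0 r
  exact mul_nonneg (by positivity) this

theorem antitoneOn_hardyKernelT (hφ : IntegrableOn φ (Ioo 0 1)) (hφ0 : 0 ≤ φ) :
    AntitoneOn (hardyKernelT φ) (Ioi 0) := by
  intro s hs t ht hst
  refine integral_mono (integrableOn_hardyKernelT hφ ht) (integrableOn_hardyKernelT hφ hs)
    fun r => mul_le_mul_of_nonneg_right ?_ (hφ0 r)
  exact Real.rpow_le_rpow_of_nonpos (lt_max_of_lt_left hs) (max_le_max_right r hst) (by norm_num)

theorem hardyKernelT_le (hφ : IntegrableOn φ (Ioo 0 1)) (hφ0 : 0 ≤ φ) {t : ℝ} (ht : 0 < t) :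
    hardyKernelT φ t ≤ t ^ (-(1 / 2) : ℝ) * ∫ r in Ioo (0 : ℝ) 1, φ r := by
  rw [← integral_const_mul]
  refine integral_mono (integrableOn_hardyKernelT hφ ht) (hφ.const_mul _)
    fun r => mul_le_mul_of_nonneg_right ?_ (hφ0 r)
  exact Real.rpow_le_rpow_of_nonpos ht (le_max_left _ _) (by norm_num)

theorem ofReal_hardyKernelT (hφ : IntegrableOn φ (Ioo 0 1)) (hφ0 : 0 ≤ φ) {t : ℝ} (ht : 0 < t) :
    ENNReal.ofReal (hardyKernelT φ t) =
      ∫⁻ r in Ioo (0 : ℝ) 1, ENNReal.ofReal (max t r ^ (-(1 / 2) : ℝ)) * ENNReal.ofReal (φ r) := by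
  have h0 (r : ℝ) : 0 ≤ max t r ^ (-(1 / 2) : ℝ) :=
    Real.rpow_nonneg (lt_max_of_lt_left ht).le _
  rw [hardyKernelT, ofReal_integral_eq_lintegral_ofReal (integrableOn_hardyKernelT hφ ht)
    (Filter.Eventually.of_forall fun r => mul_nonneg (h0 r) (hφ0 r))]
  exact lintegral_congr fun r => ENNReal.ofReal_mul (h0 r)

end Hardy

/-! ### Rearrangement of functions on the unit interval -/

section IndicatorFunctions

theorem memL1AddLinfty_of_integrable {α E : Type*} [MeasurableSpace α] [NormedAddCommGroup E]
    {ν : Measure α} {f : α → E} (hf : Integrable f ν) : MemL1AddLinfty ν f :=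
  ⟨f, 0, memLp_one_iff_integrable.2 hf, MemLp.zero, by simp⟩

theorem integrable_indicator_Ioo {φ : ℝ → ℝ} (hφ : IntegrableOn φ (Ioo 0 1)) :
    Integrable ((Ioo (0 : ℝ) 1).indicator φ) (volume.restrict (Ioi 0)) :=
  ((integrable_indicator_iff measurableSet_Ioo).2 hφ).restrict

/-- A decreasing function on `(0, 1)` dominates the rearrangement of its extension by zero. -/
theorem lintegral_rearrangement_indicator_le {φ : ℝ → ℝ} (hφ0 : 0 ≤ φ)
    (hφ : AntitoneOn φ (Ioi 0)) (t : ℝ) :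
    ∫⁻ s in Ioo 0 t, ENNReal.ofReal
        (rearrangement (volume.restrict (Ioi (0 : ℝ))) ((Ioo (0 : ℝ) 1).indicator φ) s) ≤
      ∫⁻ s in Ioo 0 (min t 1), ENNReal.ofReal (φ s) := by
  have hset : Ioo 0 (min t 1) = Iio 1 ∩ Ioo 0 t := by
    ext s
    simp only [mem_Ioo, lt_min_iff, mem_inter_iff, mem_Iio]
    tauto
  rw [hset, ← setLIntegral_indicator measurableSet_Iio]
  refine setLIntegral_mono' measurableSet_Ioo fun s hs => ?_
  have hsupp {c r : ℝ} (hc : 0 ≤ c) (h : c < ‖(Ioo (0 : ℝ) 1).indicator φ r‖) :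
      r ∈ Ioo (0 : ℝ) 1 ∧ c < φ r := by
    by_cases hr : r ∈ Ioo (0 : ℝ) 1
    · rw [indicator_of_mem hr, Real.norm_of_nonneg (hφ0 r)] at h
      exact ⟨hr, h⟩
    · rw [indicator_of_notMem hr, norm_zero] at h
      exact absurd hc (not_le.2 h)
  have hvol {c a : ℝ} (ha : ∀ r, c < ‖(Ioo (0 : ℝ) 1).indicator φ r‖ → r ∈ Ioo 0 a) :
      volume.restrict (Ioi (0 : ℝ)) {r | c < ‖(Ioo (0 : ℝ) 1).indicator φ r‖} ≤
        ENNReal.ofReal a :=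
    (Measure.restrict_apply_le _ _).trans ((measure_mono ha).trans (by simp))
  rcases lt_or_ge s 1 with h1 | h1
  · rw [indicator_of_mem (mem_Iio.2 h1)]
    refine ENNReal.ofReal_le_ofReal (rearrangement_le (hφ0 s) (hvol fun r hr => ?_))
    obtain ⟨hr1, hr2⟩ := hsupp (hφ0 s) hr
    refine ⟨hr1.1, ?_⟩
    by_contra! hsr
    exact absurd (hφ hs.1 hr1.1 hsr) (not_le.2 hr2)
  · rw [indicator_of_notMem (by simpa using h1)]
    refine (ENNReal.ofReal_eq_zero.2 (rearrangement_le le_rfl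
      ((hvol fun r hr => (hsupp le_rfl hr).1).trans (ENNReal.ofReal_le_ofReal h1)))).le

/-- A lower bound for a function on an initial interval is inherited by its rearrangement. -/
theorem ofReal_mul_le_lintegral_rearrangement {F : ℝ → ℝ}
    (hF : HasSmallTails (volume.restrict (Ioi (0 : ℝ))) F) {a t : ℝ}
    (ha : ∀ r ∈ Ioo 0 t, a ≤ F r) :
    ENNReal.ofReal a * ENNReal.ofReal t ≤ ∫⁻ s in Ioo 0 t, ENNReal.ofReal
        (rearrangement (volume.restrict (Ioi (0 : ℝ))) F s) := by
  calc ENNReal.ofReal a * ENNReal.ofReal t = ∫⁻ _ in Ioo 0 t, ENNReal.ofReal a := by simp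
    _ ≤ _ := by
      refine setLIntegral_mono' measurableSet_Ioo fun s hs => ENNReal.ofReal_le_ofReal ?_
      refine le_of_forall_lt_imp_le_of_dense fun σ hσ => le_rearrangement hF hs.1 ?_
      calc ENNReal.ofReal s < ENNReal.ofReal t :=
            (ENNReal.ofReal_lt_ofReal_iff (hs.1.trans hs.2)).2 hs.2
        _ = volume.restrict (Ioi (0 : ℝ)) (Ioo 0 t) := by
            rw [Measure.restrict_eq_self _ Ioo_subset_Ioi_self, Real.volume_Ioo, sub_zero]
        _ ≤ _ := measure_mono fun r hr => (hσ.trans_le (ha r hr)).trans_le (le_abs_self _)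

end IndicatorFunctions

end DistSobolev

open DistSobolev in
theorem theorem4p1 (d : ℕ) (hd : 0 < d) :
    ∃ c : ℝ, 0 < c ∧
      ∀ x : Lp ℂ 2 (volume : Measure (EuclideanSpace ℝ (Fin d))),
        DistSobolev.Submajorized (volume.restrict (Ioi (0 : ℝ)))
          ((Ioo (0 : ℝ) 1).indicator
            (DistSobolev.rearrangement volume (DistSobolev.besselPotential d x)))
          (c • DistSobolev.hardyT
            ((Ioo (0 : ℝ) 1).indicator (DistSobolev.rearrangement volume x))) := by
  have hc := besselConst_pos hd
  refine ⟨besselConst d, hc, fun x => ?_⟩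
  have hint (z : Lp ℂ 2 (volume : Measure (EuclideanSpace ℝ (Fin d)))) :
      IntegrableOn (rearrangement volume z) (Ioo 0 1) := by
    refine ⟨(aemeasurable_restrict_of_antitoneOn measurableSet_Ioo
      ((antitoneOn_rearrangement (hasSmallTails_of_memLp_two (Lp.memLp z))).mono
        Ioo_subset_Ioi_self)).aestronglyMeasurable, ?_⟩
    rw [hasFiniteIntegral_iff_ofReal (Filter.Eventually.of_forall
      fun r => rearrangement_nonneg _ _ r)]
    exact (lintegral_rearrangement_ne_top (Lp.memLp z)).lt_top
  set φ := rearrangement volume x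
  have hφ0 : 0 ≤ φ := fun r => rearrangement_nonneg _ _ r
  have hφi : IntegrableOn φ (Ioo 0 1) := hint x
  set A := ∫ r in Ioo (0 : ℝ) 1, φ r
  have hA0 : 0 ≤ A := integral_nonneg hφ0
  set F := besselConst d • hardyT ((Ioo (0 : ℝ) 1).indicator φ) with hF
  have hFeq : F = (Ioo (0 : ℝ) 1).indicator fun t => besselConst d * hardyKernelT φ t := by
    ext t
    by_cases ht : t ∈ Ioo (0 : ℝ) 1
    · rw [hF, Pi.smul_apply, hardyT_indicator_eq hφi ht, indicator_of_mem ht,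
        smul_eq_mul]
    · rw [hF, Pi.smul_apply, indicator_of_notMem ht, hardyT, indicator_of_notMem ht, smul_zero]
  have hFle {r : ℝ} (hr : 0 < r) : ‖F r‖ ≤ besselConst d * A * r ^ (-(1 / 2) : ℝ) := by
    rw [hFeq]
    by_cases h : r ∈ Ioo (0 : ℝ) 1
    · rw [indicator_of_mem h, Real.norm_of_nonneg
        (mul_nonneg hc.le (hardyKernelT_nonneg hφ0 hr)), mul_assoc, mul_comm A]
      gcongr
      exact hardyKernelT_le hφi hφ0 hr
    · rw [indicator_of_notMem h, norm_zero]
      positivity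
  have hFi : IntegrableOn (fun t => besselConst d * hardyKernelT φ t) (Ioo 0 1) := by
    have hdom : IntegrableOn (fun r : ℝ => besselConst d * A * r ^ (-(1 / 2) : ℝ)) (Ioo 0 1) :=
      ((intervalIntegral.integrableOn_Ioo_rpow_iff zero_lt_one).2 (by norm_num)).const_mul _
    refine Integrable.mono' hdom (((aemeasurable_restrict_of_antitoneOn measurableSet_Ioo
      ((antitoneOn_hardyKernelT hφi hφ0).mono Ioo_subset_Ioi_self)).const_mul
        _).aestronglyMeasurable) ((ae_restrict_mem measurableSet_Ioo).mono fun r hr => ?_)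
    have := hFle hr.1
    rwa [hFeq, indicator_of_mem hr] at this
  have hFt : HasSmallTails (volume.restrict (Ioi (0 : ℝ))) F := by
    refine fun s hs => ⟨besselConst d * A * s ^ (-(1 / 2) : ℝ), by positivity, ?_⟩
    rw [Measure.restrict_apply' measurableSet_Ioi]
    refine (measure_mono (t := Ioo 0 s) fun r hr => ⟨hr.2, ?_⟩).trans (by simp)
    by_contra! hsr
    refine absurd (hFle hr.2) (not_le.2 (lt_of_le_of_lt ?_ hr.1))
    exact mul_le_mul_of_nonneg_left (Real.rpow_le_rpow_of_nonpos hs hsr (by norm_num))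
      (by positivity)
  refine ⟨memL1AddLinfty_of_integrable (integrable_indicator_Ioo (hint _)), ?_, fun t ht => ?_⟩
  · rw [hFeq]
    exact memL1AddLinfty_of_integrable (integrable_indicator_Ioo hFi)
  -- both functions are supported in `(0, 1)`, so only `min t 1` matters
  set τ := min t 1
  have hτ0 : 0 < τ := lt_min ht zero_lt_one
  refine (lintegral_rearrangement_indicator_le (fun r => rearrangement_nonneg _ _ r)
    (antitoneOn_rearrangement (hasSmallTails_of_memLp_two (Lp.memLp _))) t).trans ?_
  refine (lintegral_rearrangement_besselPotential_le hd x hτ0 (min_le_right _ _)).trans ?_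
  rw [← ofReal_hardyKernelT hφi hφ0 hτ0, mul_left_comm, ← ENNReal.ofReal_mul hc.le, mul_comm]
  refine (ofReal_mul_le_lintegral_rearrangement hFt fun r hr => ?_).trans
    (lintegral_mono_set (Ioo_subset_Ioo_right (min_le_left _ _)))
  have hr1 : r ∈ Ioo (0 : ℝ) 1 := ⟨hr.1, hr.2.trans_le (min_le_right _ _)⟩
  rw [hFeq, indicator_of_mem hr1]
  exact mul_le_mul_of_nonneg_left (antitoneOn_hardyKernelT hφi hφ0 hr.1 hτ0 hr.2.le) hc.le
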